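/- **Theorem 3.2 (Equivalence to CR discretization at lowest order).** Let $d\in\{2,3\}$, let $\Omega\subset\mathbb R^d$ be a bounded polygonal/polyhedral domain (open and connected) and let $\mathcal T_h$ be a conforming simplicial mesh of $\Omega$: its finitely many closed elements cover $\overline\Omega$, and $\partial\Omega$ is the union of the boundary facets, i.e. of the facets $F\subset\partial\Omega$. Let $\nu>0$ be constant, let $\beta$ be a measurable coefficient with $0\le\beta_0\le\beta\le\beta_1$, and let $f\in L^2(\Omega)^d$. Notation. $\mathcal E_h$ is the set of facets, $m_F$ the barycenter of the facet $F$, $n_K$ the outward unit normal on $\partial K$, $\mathrm{tng}(w)=w-(w\cdot n_K)n_K$, $(\cdot,\cdot)_{\mathcal T_h}=\sum_K(\cdot,\cdot)_{L^2(K)}$, $\langle\cdot,\cdot\rangle_{\partial\mathcal T_h}=\sum_K\langle\cdot,\cdot\rangle_{L^2(\partial K)}$; $\nabla$ and $\nabla\cdot$ are taken elementwise, with $(\nabla v)_{ij}=\partial_jv_i$. The spaces are - $W$: the piecewise constant $d\times d$-matrix fields; $W_0$: the piecewise constant scalar functions with zero integral over $\Omega$; - $V=\{v\in H(\mathrm{div};\Omega):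 v|_K\in[\mathcal P^0(K)]^d\oplus x\,\mathcal P^0(K)\ \forall K\}$ (lowest-order Raviart–Thomas, RT0), and $V_0=\{v\in V: v\cdot n=0\text{ on }\partial\Omega\}$; - $\widehat V$: the vector fields on $\mathcal E_h$ that are constant on each facet $F$ and satisfy $\widehat v\cdot n|_F=0$, and $\widehat V_0=\{\widehat v\in\widehat V:\mathrm{tng}(\widehat v)|_F=0\text{ for all boundary facets }F\}$; - $V^{CR}$: the piecewise affine vector fields continuous at $m_F$ for every interior facet $F$ (Crouzeix–Raviart), and $V^{CR}_0=\{v\in V^{CR}: v(m_F)=0\text{ for all boundary facets }F\}$. For $v\in V^{CR}$ let $\Pi^{RT}v\in V$ be the field with $\int_F(\Pi^{RT}v)\cdot n_K\,ds=\int_Fv\cdot n_K\,ds$ for all $K$ and all facets $F$ of $K$. For $(v,\widehat v)\in V\times\widehat V$ let $\Pi^{CR}(v,\widehat v)\in V^{CR}$ be the field with $\Pi^{CR}(v,\widehat v)(m_F)\cdot n_K=v(m_F)\cdot n_K$ and $\mathrm{tng}(\Pi^{CR}(v,\widehat v)(m_F))=\mathrm{tng}(\widehat v(m_F))$ for all $K$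 and all facets $F$ of $K$. *HDG scheme.* Find $(L_h,u_h,\widehat u_h,p_h)\in W\times V_0\times\widehat V_0\times W_0$ such that for all $(G,v,\widehat v,q)\in W\times V_0\times\widehat V_0\times W_0$ $$(\nu^{-1}L_h,G)_{\mathcal T_h}+(\nabla u_h,G)_{\mathcal T_h}-\langle\mathrm{tng}(u_h-\widehat u_h),G\,n_K\rangle_{\partial\mathcal T_h}=0,\tag{1}$$ $$-(L_h,\nabla v)_{\mathcal T_h}+\langle L_hn_K,\mathrm{tng}(v-\widehat v)\rangle_{\partial\mathcal T_h}+(\beta u_h,v)_{\mathcal T_h}-(p_h,\nabla\cdot v)_{\mathcal T_h}=(f,v)_{\mathcal T_h},\tag{2}$$ $$(\nabla\cdot u_h,q)_{\mathcal T_h}=0.\tag{3}$$ *CR scheme.* Find $(u_h^{CR},p_h^{CR})\in V^{CR}_0\times W_0$ such that for all $(v,q)\in V^{CR}_0\times W_0$ $$\nu(\nabla u_h^{CR},\nabla v)_{\mathcal T_h}+(\beta\,\Pi^{RT}u_h^{CR},\Pi^{RT}v)_{\mathcal T_h}-(p_h^{CR},\nabla\cdot v)_{\mathcal T_h}=(f,\Pi^{RT}v)_{\mathcal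 T_h},\tag{4}$$ $$(\nabla\cdot u_h^{CR},q)_{\mathcal T_h}=0.\tag{5}$$ Then $\Pi^{RT}$ and $\Pi^{CR}$ are well defined (the fields above exist and are unique), each of the two schemes has exactly one solution, and these solutions satisfy $$L_h=-\nu\nabla u_h^{CR},\qquad \Pi^{CR}(u_h,\widehat u_h)=u_h^{CR},\qquad p_h=p_h^{CR}.$$ Moreover, the condensed HDG system, obtained by eliminating $L_h$ through (1), is the CR system: $\Pi^{CR}$ maps $V_0\times\widehat V_0$ bijectively onto $V^{CR}_0$; for $(u,\widehat u)\in V_0\times\widehat V_0$, a field $L\in W$ satisfies (1) with $(u,\widehat u)$ in place of $(u_h,\widehat u_h)$ for all $G\in W$ if and only if $L=-\nu\nabla\Pi^{CR}(u,\widehat u)$; and with this $L$, for all piecewise constant $p,q$ and all $(v,\widehat v)\in V_0\times\widehat V_0$, the left-hand side of (2) at $(L,u,p;v,\widehat v)$ equals the left-hand side of (4) at $(\Pi^{CR}(u,\widehat u),p;\Pi^{CR}(v,\widehat v))$, while $(f,v)_{\mathcal T_h}=(f,\Pi^{RT}\Pi^{CR}(v,\widehat v))_{\mathcal T_h}$ and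 $(\nabla\cdot u,q)_{\mathcal T_h}=(\nabla\cdot\Pi^{CR}(u,\widehat u),q)_{\mathcal T_h}$. -/

import Mathlib

open MeasureTheory
open scoped Matrix RealInnerProductSpace ContDiff

noncomputable section

namespace StokesHDG

/-- Points and vectors of `ℝ^d`, with the Euclidean inner product. -/
abbrev Vec (d : ℕ) := EuclideanSpace ℝ (Fin d)

/-- Real `d × d` matrices. -/
abbrev Mat (d : ℕ) := Matrix (Fin d) (Fin d) ℝ

variable {d : ℕ}

/-! ### Meshes -/

/-- A conforming simplicial mesh in `ℝ^d`: a finite geometric simplicial complex (two simplices meet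
in a common face or not at all) in which every simplex is a face of a `d`-dimensional one. -/
structure Mesh (d : ℕ) extends Geometry.SimplicialComplex ℝ (Vec d) where
  finite_faces : faces.Finite
  exists_cell : ∀ s ∈ faces, ∃ K ∈ faces, s ⊆ K ∧ K.card = d + 1

namespace Mesh

/-- The elements `K` of the mesh, given by their `d + 1` vertices. -/
abbrev Cell (T : Mesh d) := {K : Finset (Vec d) // K ∈ T.faces ∧ K.card = d + 1}

/-- The facets `F` of the mesh (simplices of codimension one), given by their `d` vertices. -/
abbrev Facet (T : Mesh d) := {F : Finset (Vec d) // F ∈ T.faces ∧ F.card = d}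

instance (T : Mesh d) : Fintype T.Cell :=
  (T.finite_faces.subset fun _ h => h.1 : {K | K ∈ T.faces ∧ K.card = d + 1}.Finite).fintype

instance (T : Mesh d) : Fintype T.Facet :=
  (T.finite_faces.subset fun _ h => h.1 : {F | F ∈ T.faces ∧ F.card = d}.Finite).fintype

end Mesh

/-- The closed simplex with the given vertices. -/
def body (s : Finset (Vec d)) : Set (Vec d) := convexHull ℝ (s : Set (Vec d))

/-- The barycenter of the simplex with the given vertices. -/
def bary (s : Finset (Vec d)) : Vec d := (s.card : ℝ)⁻¹ • ∑ x ∈ s, x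

namespace Mesh

open Classical in
/-- The facets of the element `K`. -/
def facetsOf (T : Mesh d) (K : T.Cell) : Finset T.Facet := {F | F.1 ⊆ K.1}

/-- The facet `F` lies on the boundary of `Ω`. -/
def IsBoundary (T : Mesh d) (Ω : Set (Vec d)) (F : T.Facet) : Prop := body F.1 ⊆ frontier Ω

/-- `T` is a mesh of `Ω`: the elements cover the closure of `Ω`, and the boundary of `Ω` is the
union of the boundary facets. -/
structure Triangulates (T : Mesh d) (Ω : Set (Vec d)) : Prop where
  iUnion_cell : ⋃ K : T.Cell, body K.1 = closure Ω
  iUnion_boundary : ⋃ (F : T.Facet) (_ : T.IsBoundary Ω F), body F.1 = frontier Ω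

end Mesh

/-! ### Traces on facets -/

/-- The unit normal on the facet `F` of the simplex `K` pointing out of `K`: the normalized
component of `bary F - bary K` orthogonal to `F`. -/
def normal (K F : Finset (Vec d)) : Vec d :=
  let w := (vectorSpan ℝ (F : Set (Vec d)))ᗮ.starProjection (bary F - bary K)
  ‖w‖⁻¹ • w

/-- The tangential component `w - (w ⬝ n) n`. -/
def tng (n w : Vec d) : Vec d := w - ⟪w, n⟫ • n

/-- The matrix-vector product as an element of Euclidean space. -/
def mulVec (A : Mat d) (x : Vec d) : Vec d := WithLp.toLp 2 (A *ᵥ x.ofLp)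

/-- The inner product `A : B` of matrices. -/
def frob (A B : Mat d) : ℝ := ∑ i, ∑ j, A i j * B i j

/-- The gradient `(∇ v)_{ij} = ∂_j v_i`. -/
def grad (v : Vec d → Vec d) (x : Vec d) : Mat d :=
  Matrix.of fun i j => fderiv ℝ v x (EuclideanSpace.single j 1) i

/-- The divergence `∑ i, ∂_i v_i`. -/
def dvg (v : Vec d → Vec d) (x : Vec d) : ℝ := (grad v x).trace

/-- The function on `ℝ^d` that equals `v K` in the interior of each element `K`. A piecewise
polynomial function is stored as the family `v` of polynomials representing it on the elements. -/
def assemble {M : Type*} [AddCommMonoid M] (T : Mesh d) (v : T.Cell → Vec d → M) (x : Vec d) : M :=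
  ∑ K : T.Cell, (interior (body K.1)).indicator (v K) x

/-- `v ∈ H(div; Ω)`: `v` is square integrable and has a square integrable weak divergence. -/
def MemHDiv (Ω : Set (Vec d)) (v : Vec d → Vec d) : Prop :=
  MemLp v 2 (volume.restrict Ω) ∧
    ∃ g : Vec d → ℝ, MemLp g 2 (volume.restrict Ω) ∧
      ∀ φ : Vec d → ℝ, ContDiff ℝ ∞ φ → HasCompactSupport φ → tsupport φ ⊆ Ω →
        ∫ x in Ω, fderiv ℝ φ x (v x) = - ∫ x in Ω, g x * φ x

/-! ### Lowest-order finite element spaces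

Piecewise constant functions, on the elements or on the facets, are stored as the family of their
values. -/

/-- `W_{h,0}^0`: the piecewise constants with vanishing integral over `Ω`. -/
def PZero (T : Mesh d) (Ω : Set (Vec d)) : Set (T.Cell → ℝ) :=
  {q | ∫ x in Ω, assemble T (fun K _ => q K) x = 0}

/-- `V_h^0`: the lowest-order Raviart-Thomas space. -/
def RT (T : Mesh d) (Ω : Set (Vec d)) : Set (T.Cell → Vec d → Vec d) :=
  {v | (∀ K, ∃ (a : Vec d) (b : ℝ), ∀ x, v K x = a + b • x) ∧ MemHDiv Ω (assemble T v)}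

/-- `V_{h,0}^0`: the members of `V_h^0` with vanishing normal component on the boundary. -/
def RTZero (T : Mesh d) (Ω : Set (Vec d)) : Set (T.Cell → Vec d → Vec d) :=
  {v | v ∈ RT T Ω ∧ ∀ (K : T.Cell), ∀ F ∈ T.facetsOf K, T.IsBoundary Ω F →
    ∀ x ∈ body F.1, ⟪v K x, normal K.1 F.1⟫ = 0}

/-- The space `V̂_h^0` of facetwise constant vector fields with vanishing normal component. -/
def Hat (T : Mesh d) : Set (T.Facet → Vec d) :=
  {v | ∀ (K : T.Cell), ∀ F ∈ T.facetsOf K, ⟪v F, normal K.1 F.1⟫ = 0}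

/-- `V̂_{h,0}^0`: the members of `V̂_h^0` with vanishing tangential component on the boundary. -/
def HatZero (T : Mesh d) (Ω : Set (Vec d)) : Set (T.Facet → Vec d) :=
  {v | v ∈ Hat T ∧ ∀ (K : T.Cell), ∀ F ∈ T.facetsOf K, T.IsBoundary Ω F →
    tng (normal K.1 F.1) (v F) = 0}

/-- The vector Crouzeix-Raviart space: piecewise affine vector fields that are continuous at the
barycenters of the interior facets. -/
def CR (T : Mesh d) (Ω : Set (Vec d)) : Set (T.Cell → Vec d → Vec d) :=
  {v | (∀ K, ∃ A : Vec d →ᵃ[ℝ] Vec d, v K = A) ∧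
    ∀ F : T.Facet, ¬ T.IsBoundary Ω F → ∀ K K' : T.Cell, F ∈ T.facetsOf K → F ∈ T.facetsOf K' →
      v K (bary F.1) = v K' (bary F.1)}

/-- The Crouzeix-Raviart fields that vanish at the barycenters of the boundary facets. -/
def CRZero (T : Mesh d) (Ω : Set (Vec d)) : Set (T.Cell → Vec d → Vec d) :=
  {v | v ∈ CR T Ω ∧ ∀ (K : T.Cell), ∀ F ∈ T.facetsOf K, T.IsBoundary Ω F → v K (bary F.1) = 0}

/-! ### Interpolation operators -/

/-- The integral over the facet `F` with respect to the `(d - 1)`-dimensional surface measure. -/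
def facetInt (F : Finset (Vec d)) (g : Vec d → ℝ) : ℝ := ∫ x in body F, g x ∂μHE[d - 1]

/-- `w ∈ V_h^0` has the same fluxes through all facets as `v`. -/
def IsRTInterp (T : Mesh d) (Ω : Set (Vec d)) (v w : T.Cell → Vec d → Vec d) : Prop :=
  w ∈ RT T Ω ∧ ∀ (K : T.Cell), ∀ F ∈ T.facetsOf K,
    facetInt F.1 (fun x => ⟪w K x, normal K.1 F.1⟫) =
      facetInt F.1 (fun x => ⟪v K x, normal K.1 F.1⟫)

/-- `Π^RT v`: the field in `V_h^0` with the same facet fluxes as `v`. -/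
def rtInterp (T : Mesh d) (Ω : Set (Vec d)) (v : T.Cell → Vec d → Vec d) : T.Cell → Vec d → Vec d :=
  Classical.epsilon (IsRTInterp T Ω v)

/-- `w` is a Crouzeix-Raviart field which, at the barycenter of each facet, has the normal component
of `v` and the tangential component of `v'`. -/
def IsCRInterp (T : Mesh d) (Ω : Set (Vec d)) (v : T.Cell → Vec d → Vec d) (v' : T.Facet → Vec d)
    (w : T.Cell → Vec d → Vec d) : Prop :=
  w ∈ CR T Ω ∧ ∀ (K : T.Cell), ∀ F ∈ T.facetsOf K,
    ⟪w K (bary F.1), normal K.1 F.1⟫ = ⟪v K (bary F.1), normal K.1 F.1⟫ ∧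
      tng (normal K.1 F.1) (w K (bary F.1)) = tng (normal K.1 F.1) (v' F)

/-- `Π^CR (v, v')`: the Crouzeix-Raviart field with the normal components of `v` and the tangential
components of `v'` at the barycenters of the facets. -/
def crInterp (T : Mesh d) (Ω : Set (Vec d)) (v : T.Cell → Vec d → Vec d) (v' : T.Facet → Vec d) :
    T.Cell → Vec d → Vec d :=
  Classical.epsilon (IsCRInterp T Ω v v')

/-! ### The two schemes -/

/-- `(∇·v, q)_{T_h}` -/
def divForm (T : Mesh d) (v : T.Cell → Vec d → Vec d) (q : T.Cell → ℝ) : ℝ :=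
  ∑ K : T.Cell, ∫ x in body K.1, dvg (v K) x * q K

/-- `(β u, v)_{T_h}` -/
def massForm (T : Mesh d) (β : Vec d → ℝ) (u v : T.Cell → Vec d → Vec d) : ℝ :=
  ∑ K : T.Cell, ∫ x in body K.1, β x * ⟪u K x, v K x⟫

/-- `(f, v)_{T_h}` -/
def source (T : Mesh d) (f : Vec d → Vec d) (v : T.Cell → Vec d → Vec d) : ℝ :=
  ∑ K : T.Cell, ∫ x in body K.1, ⟪f x, v K x⟫

/-- `(∇ v, G)_{T_h} - ⟨tng (v - v'), G n_K⟩_{∂T_h}` -/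
def gradForm (T : Mesh d) (v : T.Cell → Vec d → Vec d) (v' : T.Facet → Vec d)
    (G : T.Cell → Mat d) : ℝ :=
  ∑ K : T.Cell, (∫ x in body K.1, frob (grad (v K) x) (G K)) -
    ∑ K : T.Cell, ∑ F ∈ T.facetsOf K,
      facetInt F.1 (fun x => ⟪tng (normal K.1 F.1) (v K x - v' F), mulVec (G K) (normal K.1 F.1)⟫)

/-- The first equation of the HDG scheme, which determines `L` elementwise from `(u, u')`. -/
def LocalEq (T : Mesh d) (ν : ℝ) (L : T.Cell → Mat d) (u : T.Cell → Vec d → Vec d)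
    (u' : T.Facet → Vec d) : Prop :=
  ∀ G : T.Cell → Mat d,
    (∑ K : T.Cell, ∫ _x in body K.1, frob (ν⁻¹ • L K) (G K)) + gradForm T u u' G = 0

/-- The left-hand side
`-(L, ∇v)_{T_h} + ⟨L n_K, tng (v - v')⟩_{∂T_h} + (β u, v)_{T_h} - (p, ∇·v)_{T_h}`
of the second equation of the HDG scheme. -/
def hdgMomentum (T : Mesh d) (β : Vec d → ℝ) (L : T.Cell → Mat d) (u : T.Cell → Vec d → Vec d)
    (p : T.Cell → ℝ) (v : T.Cell → Vec d → Vec d) (v' : T.Facet → Vec d) : ℝ :=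
  - gradForm T v v' L + massForm T β u v - divForm T v p

/-- `(L, u, u', p)` solves the lowest-order `H(div)`-HDG scheme. -/
structure IsHDGSolution (T : Mesh d) (Ω : Set (Vec d)) (ν : ℝ) (β : Vec d → ℝ) (f : Vec d → Vec d)
    (L : T.Cell → Mat d) (u : T.Cell → Vec d → Vec d) (u' : T.Facet → Vec d)
    (p : T.Cell → ℝ) : Prop where
  mem_u : u ∈ RTZero T Ω
  mem_u' : u' ∈ HatZero T Ω
  mem_p : p ∈ PZero T Ω
  local_eq : LocalEq T ν L u u'
  momentum : ∀ v ∈ RTZero T Ω, ∀ v' ∈ HatZero T Ω, hdgMomentum T β L u p v v' = source T f v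
  incompressible : ∀ q ∈ PZero T Ω, divForm T u q = 0

/-- The left-hand side
`ν (∇u, ∇v)_{T_h} + (β Π^RT u, Π^RT v)_{T_h} - (p, ∇·v)_{T_h}`
of the first equation of the Crouzeix-Raviart scheme. -/
def crMomentum (T : Mesh d) (Ω : Set (Vec d)) (ν : ℝ) (β : Vec d → ℝ)
    (u : T.Cell → Vec d → Vec d) (p : T.Cell → ℝ) (v : T.Cell → Vec d → Vec d) : ℝ :=
  ν * (∑ K : T.Cell, ∫ x in body K.1, frob (grad (u K) x) (grad (v K) x)) +
    massForm T β (rtInterp T Ω u) (rtInterp T Ω v) - divForm T v p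

/-- `(u, p)` solves the Crouzeix-Raviart scheme with Raviart-Thomas reconstruction in the mass and
source terms. -/
structure IsCRSolution (T : Mesh d) (Ω : Set (Vec d)) (ν : ℝ) (β : Vec d → ℝ) (f : Vec d → Vec d)
    (u : T.Cell → Vec d → Vec d) (p : T.Cell → ℝ) : Prop where
  mem_u : u ∈ CRZero T Ω
  mem_p : p ∈ PZero T Ω
  momentum : ∀ v ∈ CRZero T Ω, crMomentum T Ω ν β u p v = source T f (rtInterp T Ω v)
  incompressible : ∀ q ∈ PZero T Ω, divForm T u q = 0

end StokesHDG

end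

open StokesHDG

/-!
Everything is explicit at lowest order, for two reasons. An affine function is integrated exactly
over a facet by its value at the barycenter (`facetInt_affineMap`), so all boundary terms of the two
schemes are sums over facets of values at barycenters. And an affine field on an element is
determined by its values at the barycenters of the facets (`affineMap_eq_crLoc`), as a field
`a + b x` is by its normal components there (`eq_rtLoc`).

The analytic input is the divergence theorem on a simplex for `f(x) (x - p)`, `p` a vertex. This
field is tangential on all facets but the one opposite to `p`, and integration over slices parallel
to that facet proves the formula (`cone_formula`). As the local Raviart-Thomas fields are spanned by
the fields `x - p`, the divergence theorem for their products with test functions follows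
(`integral_fderiv_add_div`). Applied to affine functions, the formula also gives the areas of the
facets and with them the identity `∑_F |F| A(m_F) ⬝ G n = |K| ∇A : G` for affine `A`
(`sum_area_inner_mulVec`).

A piecewise Raviart-Thomas field is in `H(div)` exactly if its normal jumps vanish (`mem_RT_iff`).
Constant fields are divergence free, hence the outward normals on a facet inside the domain add up
to zero (`sum_normal_eq_zero`). With this, the local formulas `rtOf` and `crOf` are seen to define
global fields, which are `Π^RT` and `Π^CR`, and `Π^CR` is a bijection under which `Π^RT` recovers
`v` (`bijOn_crInterp`, `rtInterp_crInterp`).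

The gradient form of the HDG scheme at `(v, v')` only sees the facet values `(v ⬝ n) n + tng v'`,
which are those of `Π^CR (v, v')`; thus it equals `(∇ Π^CR (v, v'), G)` (`gradForm_eq`). The first
HDG equation becomes `L = -ν ∇ Π^CR (u, u')`, and with it the remaining equations are those of the
Crouzeix-Raviart scheme (`localEq_iff`, `hdgMomentum_eq_crMomentum`, `isHDGSolution_iff`).

It remains to solve the Crouzeix-Raviart scheme, a square linear system in the facet values and the
pressures. A solution with zero data has a vanishing gradient by testing with itself; it is then
constant on each element and vanishes (`eq_zero_of_grad_eq_zero`). The pressure has no jumps across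
facets inside the domain, and is constant since the elements of a connected domain are linked
through such facets (`eq_univ_of_adjacent`).
-/

namespace StokesHDG

noncomputable section

open scoped Classical

variable {d : ℕ} {T : Mesh d} {Ω : Set (Vec d)}

section

/-! ### Barycentric coordinates on an element -/

/-- The vertices of an element, as an affine basis of `ℝ^d`. -/
def cellBasis (K : T.Cell) : AffineBasis K.1 ℝ (Vec d) where
  toFun := Subtype.val
  ind' := T.indep K.2.1
  tot' := by
    rw [(T.indep K.2.1).affineSpan_eq_top_iff_card_eq_finrank_add_one]
    simp [K.2.2]

/-- The barycentric coordinate of the element `K` belonging to the vertex `p`. -/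
def lam (K : T.Cell) (p : K.1) : Vec d →ᵃ[ℝ] ℝ := (cellBasis K).coord p

lemma lam_vertex (K : T.Cell) (p q : K.1) : lam K p q = if p = q then 1 else 0 :=
  (cellBasis K).coord_apply p q

lemma lam_self (K : T.Cell) (p : K.1) : lam K p p = 1 := by simp [lam_vertex]

lemma lam_ne (K : T.Cell) {p q : K.1} (h : p ≠ q) : lam K p q = 0 := by simp [lam_vertex, h]

lemma sum_lam (K : T.Cell) (x : Vec d) : ∑ p, lam K p x = 1 :=
  (cellBasis K).sum_coord_apply_eq_one x

lemma sum_lam_smul (K : T.Cell) (x : Vec d) : ∑ p, lam K p x • (p : Vec d) = x :=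
  (cellBasis K).linear_combination_coord_eq_self x

lemma continuous_lam (K : T.Cell) (p : K.1) : Continuous (lam K p) :=
  (lam K p).continuous_of_finiteDimensional

lemma body_cell (K : T.Cell) : body K.1 = {x | ∀ p, 0 ≤ lam K p x} := by
  have h := (cellBasis K).convexHull_eq_nonneg_coord
  rwa [show Set.range (cellBasis K) = (K.1 : Set (Vec d)) from Subtype.range_coe] at h

lemma interior_cell (K : T.Cell) : interior (body K.1) = {x | ∀ p, 0 < lam K p x} := by
  have h := (cellBasis K).interior_convexHull
  rwa [show Set.range (cellBasis K) = (K.1 : Set (Vec d)) from Subtype.range_coe] at h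

lemma affineMap_sum_smul {E : Type*} [AddCommGroup E] [Module ℝ E] {ι : Type*} (s : Finset ι)
    (A : Vec d →ᵃ[ℝ] E) (w : ι → ℝ) (x : ι → Vec d) (hw : ∑ i ∈ s, w i = 1) :
    A (∑ i ∈ s, w i • x i) = ∑ i ∈ s, w i • A (x i) := by
  rw [← s.affineCombination_eq_linear_combination x w hw, Finset.map_affineCombination _ _ _ hw,
    s.affineCombination_eq_linear_combination _ w hw]
  rfl

/-- An affine map is the interpolant of its values at the vertices. -/
lemma affineMap_eq_sum_lam {E : Type*} [AddCommGroup E] [Module ℝ E] (K : T.Cell)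
    (A : Vec d →ᵃ[ℝ] E) (x : Vec d) : A x = ∑ p, lam K p x • A p := by
  conv_lhs => rw [← sum_lam_smul K x]
  exact affineMap_sum_smul _ A _ _ (sum_lam K x)

lemma lam_bary (K : T.Cell) {s : Finset (Vec d)} (hs : s ⊆ K.1) (hn : s.Nonempty) (p : K.1) :
    lam K p (bary s) = if (p : Vec d) ∈ s then (s.card : ℝ)⁻¹ else 0 := by
  have hc : (s.card : ℝ) ≠ 0 := by exact_mod_cast hn.card_pos.ne'
  rw [bary, Finset.smul_sum, affineMap_sum_smul s (lam K p) (fun _ => (s.card : ℝ)⁻¹) (fun x => x)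
    (by simp [hc])]
  have : ∀ x ∈ s, (s.card : ℝ)⁻¹ • lam K p x = if (p : Vec d) = x then (s.card : ℝ)⁻¹ else 0 := by
    intro x hx
    have := lam_vertex K p ⟨x, hs hx⟩
    simp only [this, Subtype.ext_iff]
    split_ifs <;> simp
  rw [Finset.sum_congr rfl this]
  simp

/-- A face of an element is the set where the barycentric coordinates are nonnegative and the ones
of the opposite vertices vanish. -/
lemma mem_body_iff (K : T.Cell) {s : Finset (Vec d)} (hs : s ⊆ K.1) {x : Vec d} :
    x ∈ body s ↔ ∀ p : K.1, 0 ≤ lam K p x ∧ ((p : Vec d) ∉ s → lam K p x = 0) := by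
  constructor
  · intro hx p
    refine ⟨?_, fun hp => ?_⟩
    · have : x ∈ body K.1 := convexHull_mono (by exact_mod_cast hs) hx
      rw [body_cell] at this
      exact this p
    · have hsub : (s : Set (Vec d)) ⊆ {y | lam K p y = 0} := by
        intro q hq
        have := lam_vertex K p ⟨q, hs hq⟩
        simp only [Subtype.ext_iff] at this
        rw [Set.mem_ofPred_eq, this, if_neg]
        rintro rfl
        exact hp hq
      have hconv : Convex ℝ {y | lam K p y = 0} := by
        have := (convex_singleton (0 : ℝ)).affine_preimage (lam K p)
        exact this
      exact convexHull_min hsub hconv hx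
  · intro h
    have h1 : ∑ q ∈ s.attach, lam K ⟨q.1, hs q.2⟩ x = 1 := by
      rw [← sum_lam K x]
      refine Finset.sum_of_injOn (fun q => ⟨q.1, hs q.2⟩) ?_ ?_ ?_ ?_
      · intro a _ b _ hab
        exact Subtype.ext (congrArg (fun z : K.1 => (z : Vec d)) hab)
      · exact fun _ _ => Finset.mem_coe.2 (Finset.mem_univ _)
      · intro p _ hp
        refine (h p).2 fun hps => hp ⟨⟨p, hps⟩, by simp, rfl⟩
      · simp
    have h2 : ∑ q ∈ s.attach, lam K ⟨q.1, hs q.2⟩ x • (q : Vec d) = x := by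
      conv_rhs => rw [← sum_lam_smul K x]
      refine Finset.sum_of_injOn (fun q => ⟨q.1, hs q.2⟩) ?_ ?_ ?_ ?_
      · intro a _ b _ hab
        exact Subtype.ext (congrArg (fun z : K.1 => (z : Vec d)) hab)
      · exact fun _ _ => Finset.mem_coe.2 (Finset.mem_univ _)
      · intro p _ hp
        rw [(h p).2 fun hps => hp ⟨⟨p, hps⟩, by simp, rfl⟩, zero_smul]
      · simp
    rw [← h2]
    exact (convex_convexHull ℝ _).sum_mem (fun q _ => (h ⟨q.1, hs q.2⟩).1) h1
      fun q _ => subset_convexHull ℝ _ q.2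

lemma isCompact_body (s : Finset (Vec d)) : IsCompact (body s) :=
  s.finite_toSet.isCompact_convexHull ℝ

lemma isClosed_body (s : Finset (Vec d)) : IsClosed (body s) := (isCompact_body s).isClosed

lemma convex_body (s : Finset (Vec d)) : Convex ℝ (body s) := convex_convexHull ℝ _

lemma bary_mem_interior (K : T.Cell) : bary K.1 ∈ interior (body K.1) := by
  rw [interior_cell]
  intro p
  have hn : K.1.Nonempty := T.nonempty_of_mem_faces K.2.1
  rw [lam_bary K subset_rfl hn, if_pos p.2]
  have := hn.card_pos
  positivity

lemma cell_subset_closure_interior (K : T.Cell) : body K.1 ⊆ closure (interior (body K.1)) := by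
  rw [(convex_body K.1).closure_interior_eq_closure_of_nonempty_interior
    ⟨_, bary_mem_interior K⟩]
  exact subset_closure

lemma lam_sub (K : T.Cell) (p : K.1) (x y : Vec d) :
    lam K p x - lam K p y = (lam K p).linear (x - y) := by
  rw [← vsub_eq_sub x y, AffineMap.linearMap_vsub]
  rfl

/-- The (constant) gradient of the barycentric coordinate of the vertex `p`. -/
def gradLam (K : T.Cell) (p : K.1) : Vec d :=
  (InnerProductSpace.toDual ℝ (Vec d)).symm (LinearMap.toContinuousLinearMap (lam K p).linear)

lemma inner_gradLam (K : T.Cell) (p : K.1) (v : Vec d) : ⟪gradLam K p, v⟫ = (lam K p).linear v := by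
  simp [gradLam, InnerProductSpace.toDual_symm_apply]

lemma lam_add (K : T.Cell) (p : K.1) (x v : Vec d) :
    lam K p (x + v) = lam K p x + ⟪gradLam K p, v⟫ := by
  rw [inner_gradLam, add_comm x v, ← vadd_eq_add, AffineMap.map_vadd, vadd_eq_add, add_comm]

lemma lam_sub_eq_inner (K : T.Cell) (p : K.1) (x y : Vec d) :
    lam K p x - lam K p y = ⟪gradLam K p, x - y⟫ := by rw [lam_sub, inner_gradLam]

lemma sum_gradLam (K : T.Cell) : ∑ p, gradLam K p = 0 := by
  refine ext_inner_right ℝ fun v => ?_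
  have h1 := sum_lam K (0 + v)
  simp only [lam_add, Finset.sum_add_distrib, sum_lam] at h1
  rw [sum_inner, inner_zero_left]
  linarith

/-! ### The facets of an element -/

lemma card_erase_vertex (K : T.Cell) (p : K.1) : (K.1.erase p).card = d := by
  rw [Finset.card_erase_of_mem p.2, K.2.2, Nat.add_sub_cancel]

lemma mem_facetsOf {K : T.Cell} {F : T.Facet} : F ∈ T.facetsOf K ↔ F.1 ⊆ K.1 := by
  simp [Mesh.facetsOf]

lemma facet_nonempty (F : T.Facet) : F.1.Nonempty := T.nonempty_of_mem_faces F.2.1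

lemma bary_mem_body (F : T.Facet) : bary F.1 ∈ body F.1 := by
  have hc : (F.1.card : ℝ) ≠ 0 := by exact_mod_cast (facet_nonempty F).card_pos.ne'
  rw [bary, Finset.smul_sum]
  exact (convex_body _).sum_mem (fun _ _ => by positivity) (by simp [hc])
    fun q hq => subset_convexHull ℝ _ hq

variable [NeZero d]

lemma exists_ne_vertex (K : T.Cell) (p : K.1) : ∃ q : K.1, q ≠ p := by
  have : Nontrivial K.1 := by
    rw [← Fintype.one_lt_card_iff_nontrivial, Fintype.card_coe, K.2.2]
    have := NeZero.pos d
    omega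
  exact exists_ne p

/-- The facet of `K` opposite to the vertex `p`. -/
def opp (K : T.Cell) (p : K.1) : T.Facet :=
  ⟨K.1.erase p, T.down_closed K.2.1 (Finset.erase_subset _ _)
    (Finset.card_pos.mp (by rw [card_erase_vertex]; exact NeZero.pos d)), card_erase_vertex K p⟩

lemma opp_val (K : T.Cell) (p : K.1) : (opp K p).1 = K.1.erase p := rfl

lemma opp_injective (K : T.Cell) : Function.Injective (opp K) := by
  intro p q h
  have h' : K.1.erase p = K.1.erase q := congrArg Subtype.val h
  by_contra hpq
  have : (p : Vec d) ∈ K.1.erase q := Finset.mem_erase.2 ⟨fun h => hpq (Subtype.ext h), p.2⟩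
  rw [← h'] at this
  simp at this

lemma opp_mem (K : T.Cell) (p : K.1) : opp K p ∈ T.facetsOf K :=
  mem_facetsOf.2 (Finset.erase_subset _ _)

lemma exists_opp_eq {K : T.Cell} {F : T.Facet} (h : F ∈ T.facetsOf K) : ∃ p, opp K p = F := by
  have hs := mem_facetsOf.1 h
  have hc : (K.1 \ F.1).card = 1 := by
    rw [Finset.card_sdiff_of_subset hs, K.2.2, F.2.2]; omega
  obtain ⟨p, hp⟩ := Finset.card_eq_one.1 hc
  have hpm : p ∈ K.1 \ F.1 := by rw [hp]; simp
  refine ⟨⟨p, (Finset.mem_sdiff.1 hpm).1⟩, Subtype.ext ?_⟩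
  rw [opp_val, Finset.erase_eq, ← hp, Finset.sdiff_sdiff_eq_self hs]

lemma sum_facetsOf {M : Type*} [AddCommMonoid M] (K : T.Cell) (g : T.Facet → M) :
    ∑ F ∈ T.facetsOf K, g F = ∑ p : K.1, g (opp K p) := by
  symm
  refine Finset.sum_of_injOn (opp K) (opp_injective K).injOn (fun p _ => opp_mem K p) ?_
    fun _ _ => rfl
  intro F hF hn
  obtain ⟨p, rfl⟩ := exists_opp_eq hF
  exact absurd ⟨p, by simp, rfl⟩ hn

lemma lam_bary_opp (K : T.Cell) (p q : K.1) :
    lam K p (bary (opp K q).1) = if p = q then 0 else (d : ℝ)⁻¹ := by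
  rw [lam_bary K (mem_facetsOf.1 (opp_mem K q)) (facet_nonempty _), (opp K q).2.2, opp_val]
  by_cases h : p = q
  · simp [h]
  · have : (p : Vec d) ≠ q := fun h' => h (Subtype.ext h')
    simp [h, this]

lemma mem_body_opp {K : T.Cell} {p : K.1} {x : Vec d} :
    x ∈ body (opp K p).1 ↔ x ∈ body K.1 ∧ lam K p x = 0 := by
  rw [mem_body_iff K (mem_facetsOf.1 (opp_mem K p)), body_cell]
  constructor
  · exact fun h => ⟨fun q => (h q).1, (h p).2 (by simp [opp_val])⟩
  · rintro ⟨h1, h2⟩ q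
    refine ⟨h1 q, fun hq => ?_⟩
    have : q = p := by
      by_contra hqp
      exact hq (Finset.mem_erase.2 ⟨fun h => hqp (Subtype.ext h), q.2⟩)
    rwa [this]

lemma gradLam_ne_zero (K : T.Cell) (p : K.1) : gradLam K p ≠ 0 := by
  intro h
  obtain ⟨q, hq⟩ := exists_ne_vertex K p
  have := lam_sub_eq_inner K p p q
  rw [h, inner_zero_left, lam_self, lam_ne K hq.symm] at this
  norm_num at this

lemma norm_gradLam_pos (K : T.Cell) (p : K.1) : 0 < ‖gradLam K p‖ :=
  norm_pos_iff.2 (gradLam_ne_zero K p)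

lemma finrank_vectorSpan_facet (F : T.Facet) :
    Module.finrank ℝ (vectorSpan ℝ (F.1 : Set (Vec d))) = d - 1 := by
  have h := (T.indep F.2.1).finrank_vectorSpan (n := d - 1) (by
    rw [Fintype.card_coe, F.2.2]; have := NeZero.pos d; omega)
  rwa [show Set.range ((↑) : F.1 → Vec d) = (F.1 : Set (Vec d)) from Subtype.range_coe] at h

lemma finrank_orthogonal_facet (F : T.Facet) :
    Module.finrank ℝ (vectorSpan ℝ (F.1 : Set (Vec d)))ᗮ = 1 := by
  have h := (vectorSpan ℝ (F.1 : Set (Vec d))).finrank_add_finrank_orthogonal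
  rw [finrank_vectorSpan_facet, finrank_euclideanSpace_fin] at h
  have := NeZero.pos d
  omega

lemma gradLam_mem_orthogonal (K : T.Cell) (p : K.1) :
    gradLam K p ∈ (vectorSpan ℝ ((opp K p).1 : Set (Vec d)))ᗮ := by
  rw [Submodule.mem_orthogonal']
  intro u hu
  rw [vectorSpan_def] at hu
  induction hu using Submodule.span_induction with
  | mem x hx =>
    obtain ⟨a, ha, b, hb, rfl⟩ := hx
    have h0 : ∀ c ∈ ((opp K p).1 : Set (Vec d)), lam K p c = 0 := by
      intro c hc
      exact (mem_body_opp.1 (subset_convexHull ℝ _ hc)).2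
    simp only [vsub_eq_sub]
    rw [← lam_sub_eq_inner, h0 a ha, h0 b hb, sub_zero]
  | zero => simp
  | add x y _ _ hx hy => rw [inner_add_right, hx, hy, add_zero]
  | smul a x _ hx => rw [inner_smul_right, hx, mul_zero]

/-- Orthogonality to the facet determines a vector up to a factor. -/
lemma exists_smul_gradLam {K : T.Cell} {p : K.1} {w : Vec d}
    (hw : w ∈ (vectorSpan ℝ ((opp K p).1 : Set (Vec d)))ᗮ) : ∃ c : ℝ, w = c • gradLam K p := by
  obtain ⟨c, hc⟩ := (finrank_eq_one_iff_of_nonzero'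
    (⟨gradLam K p, gradLam_mem_orthogonal K p⟩ : (vectorSpan ℝ ((opp K p).1 : Set (Vec d)))ᗮ)
    (by simpa [Subtype.ext_iff] using gradLam_ne_zero K p)).1 (finrank_orthogonal_facet _) ⟨w, hw⟩
  exact ⟨c, by simpa [Subtype.ext_iff] using hc.symm⟩

/-- The barycentric coordinate of `p` decreases in the direction of the outward normal on the facet
opposite to `p`. -/
lemma normal_opp (K : T.Cell) (p : K.1) :
    normal K.1 (opp K p).1 = -(‖gradLam K p‖⁻¹ • gradLam K p) := by
  set S := (vectorSpan ℝ ((opp K p).1 : Set (Vec d)))ᗮ with hS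
  set v := bary (opp K p).1 - bary K.1 with hv
  obtain ⟨c, hc⟩ : ∃ c : ℝ, S.starProjection v = c • gradLam K p :=
    exists_smul_gradLam (Submodule.starProjection_apply_mem S v)
  have hg := norm_gradLam_pos K p
  have h1 : ⟪gradLam K p, S.starProjection v⟫ = ⟪gradLam K p, v⟫ := by
    rw [← S.inner_starProjection_left_eq_right,
      S.starProjection_eq_self_iff.2 (gradLam_mem_orthogonal K p)]
  have h2 : ⟪gradLam K p, v⟫ < 0 := by
    rw [hv, ← lam_sub_eq_inner, lam_bary_opp, if_pos rfl]
    have := bary_mem_interior K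
    rw [interior_cell] at this
    have := this p
    linarith
  have hc0 : c < 0 := by
    rw [← h1, hc, inner_smul_right, real_inner_self_eq_norm_sq] at h2
    by_contra hcn
    push Not at hcn
    have : 0 ≤ c * ‖gradLam K p‖ ^ 2 := by positivity
    linarith
  change ‖S.starProjection v‖⁻¹ • S.starProjection v = _
  rw [hc, norm_smul, Real.norm_eq_abs, abs_of_neg hc0, smul_smul, ← neg_smul]
  congr 1
  field_simp [hc0.ne, hg.ne']

lemma gradLam_eq (K : T.Cell) (p : K.1) :
    gradLam K p = -(‖gradLam K p‖ • normal K.1 (opp K p).1) := by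
  have hg := norm_gradLam_pos K p
  rw [normal_opp, smul_neg, neg_neg, smul_smul, mul_inv_cancel₀ hg.ne', one_smul]

lemma norm_normal_opp (K : T.Cell) (p : K.1) : ‖normal K.1 (opp K p).1‖ = 1 := by
  have hg := norm_gradLam_pos K p
  rw [normal_opp, norm_neg, norm_smul, norm_inv, norm_norm, inv_mul_cancel₀ hg.ne']

lemma norm_normal {K : T.Cell} {F : T.Facet} (h : F ∈ T.facetsOf K) : ‖normal K.1 F.1‖ = 1 := by
  obtain ⟨p, rfl⟩ := exists_opp_eq h
  exact norm_normal_opp K p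

lemma inner_normal_self {K : T.Cell} {F : T.Facet} (h : F ∈ T.facetsOf K) :
    ⟪normal K.1 F.1, normal K.1 F.1⟫ = 1 := by
  rw [real_inner_self_eq_norm_sq, norm_normal h, one_pow]

lemma normal_mem_orthogonal {K : T.Cell} {F : T.Facet} (h : F ∈ T.facetsOf K) :
    normal K.1 F.1 ∈ (vectorSpan ℝ (F.1 : Set (Vec d)))ᗮ := by
  obtain ⟨p, rfl⟩ := exists_opp_eq h
  rw [normal_opp]
  exact neg_mem (Submodule.smul_mem _ _ (gradLam_mem_orthogonal K p))

/-- On a common facet, two elements have the same outward normal or opposite ones. -/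
lemma normal_eq_or_neg {K K' : T.Cell} {F : T.Facet} (h : F ∈ T.facetsOf K)
    (h' : F ∈ T.facetsOf K') :
    normal K'.1 F.1 = normal K.1 F.1 ∨ normal K'.1 F.1 = -normal K.1 F.1 := by
  have hn' := normal_mem_orthogonal h'
  obtain ⟨p, rfl⟩ := exists_opp_eq h
  obtain ⟨c, hc⟩ := exists_smul_gradLam hn'
  rw [gradLam_eq, smul_neg, smul_smul, ← neg_smul] at hc
  have h1 := norm_normal h'
  rw [hc, norm_smul, norm_normal h, mul_one, Real.norm_eq_abs] at h1
  rcases eq_or_eq_neg_of_abs_eq h1 with h2 | h2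
  · left; rw [hc, h2, one_smul]
  · right; rw [hc, h2, neg_one_smul]

end

section

/-! ### The divergence theorem on an element -/

/-- Fubini's theorem along the hyperplanes orthogonal to a unit vector. -/
lemma integral_eq_integral_hyperplanes (S : Submodule ℝ (Vec d)) (hS : Module.finrank ℝ Sᗮ = 1)
    {n : Vec d} (hn : n ∈ Sᗮ) (hn1 : ‖n‖ = 1) (p : Vec d) {g : Vec d → ℝ} (hg : Integrable g) :
    ∫ x, g x = ∫ t : ℝ, ∫ z : S, g (p + z + t • n) := by
  have hn1' : ‖(⟨n, hn⟩ : Sᗮ)‖ = 1 := hn1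
  let e : ℝ ≃ₗᵢ[ℝ] Sᗮ := (LinearIsometry.toSpanSingleton ℝ Sᗮ hn1').toLinearIsometryEquiv
    (by rw [hS, Module.finrank_self])
  have he : ∀ t : ℝ, (e t : Vec d) = t • n := fun t => by
    change ((LinearIsometry.toSpanSingleton ℝ Sᗮ hn1' t : Sᗮ) : Vec d) = t • n
    rw [LinearIsometry.toSpanSingleton_apply]
    rfl
  have hm1 : MeasurePreserving (S.measurableEquivProd p) volume volume := by
    have := S.measurePreserving_measurableEquivProd p
    rwa [InnerProductSpace.euclideanHausdorffMeasure_eq_volume] at this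
  let E : S × ℝ ≃ᵐ Vec d :=
    ((MeasurableEquiv.refl S).prodCongr e.toHomeomorph.toMeasurableEquiv).trans
      (S.measurableEquivProd p).symm
  have hE : MeasurePreserving E (volume.prod volume) volume :=
    (MeasurePreserving.prod (MeasurePreserving.id _) e.measurePreserving).trans
      (MeasurePreserving.symm _ hm1)
  have hEa : ∀ z : S × ℝ, E z = p + z.1 + z.2 • n := fun z => by
    have : E z = (S.measurableEquivProd p).symm (z.1, e z.2) := rfl
    rw [this, Submodule.measurableEquivProd_symm_apply]
    simp only [he, vadd_eq_add]
    abel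
  have hi : Integrable (fun z => g (E z)) (volume.prod volume) :=
    (hE.integrable_comp_emb E.measurableEmbedding).2 hg
  rw [← hE.integral_comp', integral_prod_symm _ hi]
  simp_rw [hEa]

variable [NeZero d]

/-- The position of the points `p + z + s n / |∇ λ_p|`, `z` parallel to the facet opposite to `p`,
relative to the apex `p` and that facet. -/
lemma lam_cone (K : T.Cell) (p : K.1) (z : vectorSpan ℝ ((opp K p).1 : Set (Vec d))) (s : ℝ) :
    lam K p (p + (z : Vec d) + (‖gradLam K p‖⁻¹ * s) • normal K.1 (opp K p).1) = 1 - s := by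
  have hg := norm_gradLam_pos K p
  rw [add_assoc, lam_add, lam_self, inner_add_right,
    Submodule.inner_left_of_mem_orthogonal z.2 (gradLam_mem_orthogonal K p), normal_opp,
    smul_neg, inner_neg_right, inner_smul_right, inner_smul_right, real_inner_self_eq_norm_sq]
  field_simp
  ring

/-- The parametrization of the hyperplane of the facet opposite to `p` by its direction. -/
def facetChart (K : T.Cell) (p : K.1) (z : vectorSpan ℝ ((opp K p).1 : Set (Vec d))) : Vec d :=
  p + ((z : Vec d) + ‖gradLam K p‖⁻¹ • normal K.1 (opp K p).1)

lemma isometry_facetChart (K : T.Cell) (p : K.1) : Isometry (facetChart K p) := by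
  refine Isometry.of_dist_eq fun a b => ?_
  simp [facetChart, dist_eq_norm]

lemma range_facetChart (K : T.Cell) (p : K.1) : body (opp K p).1 ⊆ Set.range (facetChart K p) := by
  intro x hx
  set n := normal K.1 (opp K p).1 with hn
  have hg := norm_gradLam_pos K p
  have hmem : x - p - ‖gradLam K p‖⁻¹ • n ∈ vectorSpan ℝ ((opp K p).1 : Set (Vec d)) := by
    rw [← Submodule.orthogonal_orthogonal (vectorSpan ℝ ((opp K p).1 : Set (Vec d))),
      Submodule.mem_orthogonal]
    intro u hu
    obtain ⟨c, rfl⟩ := exists_smul_gradLam hu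
    have h1 := lam_sub_eq_inner K p x p
    rw [(mem_body_opp.1 hx).2, lam_self] at h1
    rw [inner_smul_left, inner_sub_right, ← h1, hn, normal_opp, smul_neg, inner_neg_right,
      inner_smul_right, inner_smul_right, real_inner_self_eq_norm_sq]
    field_simp
    simp
  refine ⟨⟨_, hmem⟩, ?_⟩
  simp only [facetChart]
  abel

lemma isCompact_preimage_facetChart (K : T.Cell) (p : K.1) :
    IsCompact (facetChart K p ⁻¹' body (opp K p).1) :=
  (isometry_facetChart K p).isClosedEmbedding.isCompact_preimage (isCompact_body _)

lemma facetInt_eq_integral_chart (K : T.Cell) (p : K.1) (f : Vec d → ℝ) :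
    facetInt (opp K p).1 f = ∫ z in facetChart K p ⁻¹' body (opp K p).1, f (facetChart K p z) := by
  have hr : (μHE[d - 1] : Measure (vectorSpan ℝ ((opp K p).1 : Set (Vec d)))) = volume := by
    rw [← finrank_vectorSpan_facet (opp K p)]
    exact InnerProductSpace.euclideanHausdorffMeasure_eq_volume
  rw [facetInt, ← (isometry_facetChart K p).isClosedEmbedding.measurableEmbedding.setIntegral_map,
    ← hr, (isometry_facetChart K p).map_euclideanHausdorffMeasure,
    Measure.restrict_restrict (isClosed_body _).measurableSet,
    Set.inter_eq_left.2 (range_facetChart K p)]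

/-- Points on the segment from the apex `p` to the opposite facet. -/
def conePoint (K : T.Cell) (p : K.1) (s : ℝ)
    (z : vectorSpan ℝ ((opp K p).1 : Set (Vec d))) : Vec d :=
  p + s • (facetChart K p z - p)

lemma conePoint_mem_body (K : T.Cell) (p : K.1) {s : ℝ} (h0 : 0 < s) (h1 : s ≤ 1)
    (z : vectorSpan ℝ ((opp K p).1 : Set (Vec d))) :
    conePoint K p s z ∈ body K.1 ↔ facetChart K p z ∈ body (opp K p).1 := by
  have hp : lam K p (facetChart K p z) = 0 := by
    have := lam_cone K p z 1
    rw [mul_one, add_assoc, sub_self] at this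
    exact this
  have hq : ∀ q, lam K q (conePoint K p s z) =
      (1 - s) * lam K q p + s * lam K q (facetChart K p z) := by
    intro q
    rw [conePoint, lam_add, inner_smul_right, ← lam_sub_eq_inner]
    ring
  rw [mem_body_opp, body_cell, Set.mem_ofPred_eq, Set.mem_ofPred_eq]
  constructor
  · refine fun h => ⟨fun q => ?_, hp⟩
    by_cases hqp : q = p
    · rw [hqp, hp]
    · have := h q
      rw [hq, lam_ne K hqp, mul_zero, zero_add] at this
      exact nonneg_of_mul_nonneg_right this h0
  · rintro ⟨h, -⟩ q
    rw [hq]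
    have h2 : 0 ≤ lam K q p := by rw [lam_vertex]; split_ifs <;> norm_num
    have := h q
    have : 0 ≤ 1 - s := by linarith
    positivity

/-- Integration over an element by slices parallel to a facet: the slice at relative distance `s`
from the apex `p` is the facet scaled by `s`, whence the weight `s ^ (d - 1)`. -/
lemma setIntegral_cell_eq_cone (K : T.Cell) (p : K.1) {f : Vec d → ℝ} (hf : Continuous f) :
    ∫ x in body K.1, f x = ‖gradLam K p‖⁻¹ * ∫ s in Set.Ioc (0 : ℝ) 1,
      ∫ z in facetChart K p ⁻¹' body (opp K p).1, s ^ (d - 1) * f (conePoint K p s z) := by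
  have hg := norm_gradLam_pos K p
  set n := normal K.1 (opp K p).1 with hn
  set g := (body K.1).indicator f with hgdef
  set A := facetChart K p ⁻¹' body (opp K p).1 with hA
  have hKm : MeasurableSet (body K.1) := (isClosed_body _).measurableSet
  have hAm : MeasurableSet A := (isCompact_preimage_facetChart K p).measurableSet
  have hint : Integrable g :=
    (hf.continuousOn.integrableOn_compact (isCompact_body _)).integrable_indicator hKm
  rw [← integral_indicator hKm, integral_eq_integral_hyperplanes _
    (finrank_orthogonal_facet (opp K p)) (normal_mem_orthogonal (opp_mem K p))
    (norm_normal_opp K p) p hint]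
  have hsc := Measure.integral_comp_mul_left
    (fun t => ∫ z : vectorSpan ℝ ((opp K p).1 : Set (Vec d)), g (p + z + t • n)) ‖gradLam K p‖⁻¹
  rw [inv_inv, abs_of_pos hg, smul_eq_mul] at hsc
  rw [eq_comm, ← eq_inv_mul_iff_mul_eq₀ hg.ne'] at hsc
  rw [hsc, ← integral_indicator measurableSet_Ioc]
  congr 1
  refine integral_congr_ae ?_
  filter_upwards [compl_mem_ae_iff.2 (measure_singleton (0 : ℝ))] with s hs
  have hs0 : s ≠ 0 := hs
  by_cases hs1 : s ∈ Set.Ioc (0 : ℝ) 1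
  · rw [Set.indicator_of_mem hs1]
    have hcs := Measure.integral_comp_smul volume
      (fun z : vectorSpan ℝ ((opp K p).1 : Set (Vec d)) =>
        g (p + z + (‖gradLam K p‖⁻¹ * s) • n)) s
    rw [finrank_vectorSpan_facet, abs_of_pos (inv_pos.2 (pow_pos hs1.1 _)), smul_eq_mul,
      eq_comm, inv_mul_eq_iff_eq_mul₀ (pow_pos hs1.1 _).ne'] at hcs
    rw [hcs, integral_const_mul, ← integral_indicator hAm]
    congr 1
    refine integral_congr_ae (Filter.Eventually.of_forall fun z => ?_)
    have hpt : (p : Vec d) + ((s • z : vectorSpan ℝ ((opp K p).1 : Set (Vec d))) : Vec d) +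
        (‖gradLam K p‖⁻¹ * s) • n = conePoint K p s z := by
      simp only [conePoint, facetChart, Submodule.coe_smul, add_sub_cancel_left, smul_add,
        smul_smul, ← hn, mul_comm s, add_assoc]
    simp only [hpt, hgdef]
    by_cases hz : z ∈ A
    · rw [Set.indicator_of_mem hz, Set.indicator_of_mem
        ((conePoint_mem_body K p hs1.1 hs1.2 z).2 hz)]
    · rw [Set.indicator_of_notMem hz, Set.indicator_of_notMem
        (fun h => hz ((conePoint_mem_body K p hs1.1 hs1.2 z).1 h))]
  · rw [Set.indicator_of_notMem hs1]
    refine integral_eq_zero_of_ae (Filter.Eventually.of_forall fun z => ?_)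
    refine Set.indicator_of_notMem (fun h => hs1 ?_) _
    rw [body_cell] at h
    have h1 := h p
    have h2 : lam K p (p + (z : Vec d) + (‖gradLam K p‖⁻¹ * s) • n) ≤ 1 := by
      rw [← sum_lam K (p + (z : Vec d) + (‖gradLam K p‖⁻¹ * s) • n)]
      exact Finset.single_le_sum (fun q _ => h q) (Finset.mem_univ p)
    rw [hn, lam_cone] at h1 h2
    exact ⟨lt_of_le_of_ne (by linarith) hs0.symm, by linarith⟩

/-- The divergence theorem for the field `f(x) (x - p)`, which is tangential on all facets through
the vertex `p`. On the rays from `p` the integrand is the derivative of `s ^ d * f`. -/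
lemma cone_formula (K : T.Cell) (p : K.1) {f : Vec d → ℝ} (hf : ContDiff ℝ 1 f) :
    ∫ x in body K.1, (d * f x + fderiv ℝ f x (x - p)) =
      ‖gradLam K p‖⁻¹ * facetInt (opp K p).1 f := by
  have hd : d - 1 + 1 = d := Nat.sub_add_cancel (NeZero.pos d)
  have hf' : Continuous (fderiv ℝ f) := hf.continuous_fderiv one_ne_zero
  have hcf : Continuous f := hf.continuous
  have hc : Continuous fun x => d * f x + fderiv ℝ f x (x - p) := by fun_prop
  have hchart : Continuous (facetChart K p) := (isometry_facetChart K p).continuous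
  have hcone : Continuous fun w : ℝ × vectorSpan ℝ ((opp K p).1 : Set (Vec d)) =>
      conePoint K p w.1 w.2 := by
    unfold conePoint
    fun_prop
  have hcont : Continuous fun w : ℝ × vectorSpan ℝ ((opp K p).1 : Set (Vec d)) =>
      w.1 ^ (d - 1) * (d * f (conePoint K p w.1 w.2) +
        fderiv ℝ f (conePoint K p w.1 w.2) (conePoint K p w.1 w.2 - p)) :=
    (continuous_fst.pow _).mul (hc.comp hcone)
  rw [setIntegral_cell_eq_cone K p hc, facetInt_eq_integral_chart, integral_integral_swap]
  · congr 1
    refine integral_congr_ae (Filter.Eventually.of_forall fun z => ?_)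
    have hder : ∀ s : ℝ, HasDerivAt (fun s : ℝ => s ^ d * f (conePoint K p s z))
        (s ^ (d - 1) * (d * f (conePoint K p s z) +
          fderiv ℝ f (conePoint K p s z) (conePoint K p s z - p))) s := by
      intro s
      have h1 : HasDerivAt (fun s : ℝ => conePoint K p s z) (facetChart K p z - p) s := by
        have h := ((hasDerivAt_id s).smul_const (facetChart K p z - p)).const_add (p : Vec d)
        rw [one_smul] at h
        exact h
      have h2 := (hf.differentiable one_ne_zero (conePoint K p s z)).hasFDerivAt.comp_hasDerivAt
        s h1
      refine ((hasDerivAt_pow d s).mul h2).congr_deriv ?_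
      have : conePoint K p s z - p = s • (facetChart K p z - p) := by simp [conePoint]
      rw [this, map_smul, smul_eq_mul]
      have hp : s ^ d = s ^ (d - 1) * s := by rw [← pow_succ, hd]
      simp only [Function.comp, hp]
      ring
    have hI := intervalIntegral.integral_eq_sub_of_hasDerivAt (a := 0) (b := 1)
      (fun s _ => hder s)
      ((hcont.comp (by fun_prop : Continuous fun s : ℝ => (s, z))).intervalIntegrable 0 1)
    rw [intervalIntegral.integral_of_le zero_le_one] at hI
    change ∫ s in Set.Ioc (0 : ℝ) 1, _ = _
    rw [hI, one_pow, one_mul, zero_pow (NeZero.ne d), zero_mul, sub_zero, conePoint, one_smul,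
      add_sub_cancel]
  · rw [Measure.prod_restrict]
    refine IntegrableOn.mono_set ?_ (Set.prod_mono Set.Ioc_subset_Icc_self subset_rfl)
    exact hcont.continuousOn.integrableOn_compact
      (isCompact_Icc.prod (isCompact_preimage_facetChart K p))

end

section

/-! ### The gradient of affine fields -/

lemma contDiff_affineMap {E : Type*} [NormedAddCommGroup E] [NormedSpace ℝ E]
    (A : Vec d →ᵃ[ℝ] E) {n : ℕ∞ω} : ContDiff ℝ n A := by
  rw [AffineMap.decomp A]
  exact (LinearMap.toContinuousLinearMap A.linear).contDiff.add contDiff_const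

lemma fderiv_affineMap {E : Type*} [NormedAddCommGroup E] [NormedSpace ℝ E]
    (A : Vec d →ᵃ[ℝ] E) (x v : Vec d) : fderiv ℝ A x v = A.linear v := by
  have h : HasFDerivAt A (LinearMap.toContinuousLinearMap A.linear) x := by
    have := (LinearMap.toContinuousLinearMap A.linear).hasFDerivAt (x := x) |>.add_const (A 0)
    rwa [show (fun y => (LinearMap.toContinuousLinearMap A.linear) y + A 0) = A from
      (AffineMap.decomp A).symm] at this
  rw [h.fderiv]
  rfl

/-- The gradient of an affine vector field. -/
def affGrad (A : Vec d →ᵃ[ℝ] Vec d) : Mat d :=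
  Matrix.of fun i j => A.linear (EuclideanSpace.single j 1) i

lemma grad_affineMap (A : Vec d →ᵃ[ℝ] Vec d) (x : Vec d) : grad A x = affGrad A := by
  ext i j
  simp [grad, affGrad, fderiv_affineMap]

/-- The linear part of an affine map in terms of the values at the vertices. -/
lemma affineMap_linear_eq (K : T.Cell) (A : Vec d →ᵃ[ℝ] Vec d) (v : Vec d) :
    A.linear v = ∑ p : K.1, ⟪gradLam K p, v⟫ • A p := by
  have h : A.linear v = A v - A 0 := by
    rw [← vsub_eq_sub (A v), ← AffineMap.linearMap_vsub, vsub_eq_sub, sub_zero]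
  rw [h, affineMap_eq_sum_lam K A v, affineMap_eq_sum_lam K A 0, ← Finset.sum_sub_distrib]
  refine Finset.sum_congr rfl fun p _ => ?_
  rw [← sub_smul, lam_sub_eq_inner, sub_zero]

lemma mulVec_add (G : Mat d) (x y : Vec d) : mulVec G (x + y) = mulVec G x + mulVec G y := by
  ext i; simp [mulVec, Matrix.mulVec_add]

lemma mulVec_smul (G : Mat d) (c : ℝ) (x : Vec d) : mulVec G (c • x) = c • mulVec G x := by
  ext i; simp [mulVec, Matrix.mulVec_smul]

lemma mulVec_neg (G : Mat d) (x : Vec d) : mulVec G (-x) = -mulVec G x := by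
  simpa using mulVec_smul G (-1) x

lemma mulVec_sum {ι : Type*} (s : Finset ι) (G : Mat d) (x : ι → Vec d) :
    mulVec G (∑ i ∈ s, x i) = ∑ i ∈ s, mulVec G (x i) :=
  map_sum (⟨⟨mulVec G, by ext i; simp [mulVec]⟩, mulVec_add G⟩ : Vec d →+ Vec d) x s

lemma mulVec_one (x : Vec d) : mulVec 1 x = x := by ext i; simp [mulVec]

lemma frob_one (A : Mat d) : frob A 1 = A.trace := by
  simp [frob, Matrix.trace, Matrix.one_apply]

lemma dvg_eq_frob (v : Vec d → Vec d) (x : Vec d) : dvg v x = frob (grad v x) 1 := (frob_one _).symm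

lemma frob_affGrad (K : T.Cell) (A : Vec d →ᵃ[ℝ] Vec d) (G : Mat d) :
    frob (affGrad A) G = ∑ p : K.1, ⟪A p, mulVec G (gradLam K p)⟫ := by
  have h1 : ∀ i j, affGrad A i j = ∑ p : K.1, gradLam K p j * A p i := by
    intro i j
    simp [affGrad, affineMap_linear_eq K A, EuclideanSpace.inner_single_right]
  have h2 : ∀ p : K.1, ⟪A p, mulVec G (gradLam K p)⟫ =
      ∑ i, ∑ j, gradLam K p j * A p i * G i j := by
    intro p
    simp only [PiLp.inner_apply, mulVec, Matrix.mulVec, dotProduct, RCLike.inner_apply,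
      conj_trivial, Finset.sum_mul]
    refine Finset.sum_congr rfl fun i _ => Finset.sum_congr rfl fun j _ => by ring
  simp_rw [h2, frob, h1, Finset.sum_mul]
  rw [Finset.sum_comm' (t' := Finset.univ) (s' := fun _ => Finset.univ) (by simp)]
  rw [Finset.sum_comm (γ := K.1)]
  simp_rw [Finset.sum_comm (γ := K.1)]
  exact Finset.sum_comm

/-! ### Exact integration of affine functions -/

lemma volume_cell_pos (K : T.Cell) : 0 < volume.real (body K.1) := by
  refine ENNReal.toReal_pos ?_ (isCompact_body K.1).measure_lt_top.ne
  have h : volume (interior (body K.1)) ≠ 0 :=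
    (isOpen_interior.measure_pos volume ⟨_, bary_mem_interior K⟩).ne'
  exact fun h0 => h (measure_mono_null interior_subset h0)

lemma integrableOn_cell {E : Type*} [NormedAddCommGroup E] (K : T.Cell) {f : Vec d → E}
    (hf : Continuous f) : IntegrableOn f (body K.1) :=
  hf.continuousOn.integrableOn_compact (isCompact_body _)

lemma facetInt_const_mul (F : Finset (Vec d)) (c : ℝ) (f : Vec d → ℝ) :
    facetInt F (fun x => c * f x) = c * facetInt F f := integral_const_mul _ _

lemma facetInt_congr {F : Finset (Vec d)} {f g : Vec d → ℝ} (h : ∀ x ∈ body F, f x = g x) :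
    facetInt F f = facetInt F g := setIntegral_congr_fun (isClosed_body F).measurableSet h

/-- The surface measure of a facet. -/
def area (F : Finset (Vec d)) : ℝ := facetInt F fun _ => 1

lemma facetInt_const (F : Finset (Vec d)) (c : ℝ) : facetInt F (fun _ => c) = c * area F := by
  rw [area, ← facetInt_const_mul]
  simp

lemma integral_frob_grad (K : T.Cell) (A : Vec d →ᵃ[ℝ] Vec d) (G : Mat d) :
    ∫ x in body K.1, frob (grad A x) G = volume.real (body K.1) * frob (affGrad A) G := by
  simp_rw [grad_affineMap]
  rw [setIntegral_const, smul_eq_mul]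

variable [NeZero d]

lemma integral_lam (K : T.Cell) (p : K.1) :
    ∫ x in body K.1, lam K p x = volume.real (body K.1) / (d + 1) := by
  have h := cone_formula K p (contDiff_affineMap (lam K p))
  rw [facetInt_congr (g := fun _ => 0) (fun x hx => (mem_body_opp.1 hx).2), facetInt_const,
    zero_mul, mul_zero] at h
  have h1 : ∀ x, (d * lam K p x + fderiv ℝ (lam K p) x (x - p)) = (d + 1) * lam K p x - 1 := by
    intro x
    rw [fderiv_affineMap, ← lam_sub, lam_self]
    ring
  simp_rw [h1] at h
  rw [integral_sub ((integrableOn_cell K (continuous_lam K p)).const_mul _)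
    (integrableOn_cell K continuous_const), integral_const_mul, setIntegral_const, smul_eq_mul,
    mul_one] at h
  have : (d : ℝ) + 1 ≠ 0 := by positivity
  field_simp
  linarith

lemma integral_affineMap_cell (K : T.Cell) (A : Vec d →ᵃ[ℝ] ℝ) :
    ∫ x in body K.1, A x = volume.real (body K.1) / (d + 1) * ∑ p : K.1, A p := by
  have h : ∀ x, A x = ∑ p : K.1, lam K p x * A p := affineMap_eq_sum_lam K A
  rw [integral_congr_ae (Filter.Eventually.of_forall h), integral_finsetSum _ fun p _ =>
    (integrableOn_cell K (continuous_lam K p)).mul_const _]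
  simp_rw [integral_mul_const, integral_lam]
  rw [Finset.mul_sum]

lemma affineMap_bary_opp {E : Type*} [AddCommGroup E] [Module ℝ E] (K : T.Cell) (p : K.1)
    (A : Vec d →ᵃ[ℝ] E) : A (bary (opp K p).1) = (d : ℝ)⁻¹ • (∑ q : K.1, A q - A p) := by
  rw [affineMap_eq_sum_lam K A]
  simp_rw [lam_bary_opp, ite_smul, zero_smul]
  rw [← Finset.sum_erase_eq_sub (Finset.mem_univ p), Finset.smul_sum, Finset.sum_ite,
    Finset.sum_const_zero, zero_add]
  refine Finset.sum_congr ?_ fun _ _ => rfl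
  ext q
  simp

/-- The cone formula for an affine function: both sides are integrals over the element, which the
vertex values determine. -/
lemma facetInt_affineMap_aux (K : T.Cell) (p : K.1) (A : Vec d →ᵃ[ℝ] ℝ) :
    ‖gradLam K p‖⁻¹ * facetInt (opp K p).1 A =
      d * volume.real (body K.1) * A (bary (opp K p).1) := by
  rw [← cone_formula K p (contDiff_affineMap A)]
  have h1 : ∀ x, (d * A x + fderiv ℝ A x (x - p)) = (d + 1) * A x - A p := by
    intro x
    rw [fderiv_affineMap, ← vsub_eq_sub x, AffineMap.linearMap_vsub, vsub_eq_sub]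
    ring
  simp_rw [h1]
  rw [integral_sub ((integrableOn_cell K (contDiff_affineMap (n := 0) A).continuous).const_mul _)
    (integrableOn_cell K continuous_const), integral_const_mul, setIntegral_const, smul_eq_mul,
    integral_affineMap_cell, affineMap_bary_opp, smul_eq_mul]
  have : (d : ℝ) ≠ 0 := Nat.cast_ne_zero.2 (NeZero.ne d)
  have : (d : ℝ) + 1 ≠ 0 := by positivity
  field_simp

lemma area_opp (K : T.Cell) (p : K.1) :
    area (opp K p).1 = d * volume.real (body K.1) * ‖gradLam K p‖ := by
  have h := facetInt_affineMap_aux K p (AffineMap.const ℝ _ 1)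
  have hg := norm_gradLam_pos K p
  rw [AffineMap.const_apply, mul_one, inv_mul_eq_iff_eq_mul₀ hg.ne', mul_comm] at h
  exact h

lemma area_pos {K : T.Cell} {F : T.Facet} (h : F ∈ T.facetsOf K) : 0 < area F.1 := by
  obtain ⟨p, rfl⟩ := exists_opp_eq h
  rw [area_opp]
  have := NeZero.pos d
  have := volume_cell_pos K
  have := norm_gradLam_pos K p
  positivity

/-- The midpoint rule on a facet is exact for affine functions. -/
lemma facetInt_affineMap {K : T.Cell} {F : T.Facet} (h : F ∈ T.facetsOf K)
    (A : Vec d →ᵃ[ℝ] ℝ) : facetInt F.1 A = area F.1 * A (bary F.1) := by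
  obtain ⟨p, rfl⟩ := exists_opp_eq h
  have h := facetInt_affineMap_aux K p A
  have hg := norm_gradLam_pos K p
  rw [inv_mul_eq_iff_eq_mul₀ hg.ne'] at h
  rw [h, area_opp]
  ring

lemma facetInt_inner_affineMap {K : T.Cell} {F : T.Facet} (h : F ∈ T.facetsOf K)
    (A : Vec d →ᵃ[ℝ] Vec d) (c w : Vec d) :
    facetInt F.1 (fun x => ⟪A x - c, w⟫) = area F.1 * ⟪A (bary F.1) - c, w⟫ := by
  have := facetInt_affineMap h
    ((innerₛₗ ℝ w).toAffineMap.comp (A - AffineMap.const ℝ (Vec d) c))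
  simpa [real_inner_comm, Function.comp_def] using this

/-- The divergence theorem for affine fields, tested with a constant matrix. -/
lemma sum_area_inner_mulVec (K : T.Cell) (A : Vec d →ᵃ[ℝ] Vec d) (G : Mat d) :
    ∑ F ∈ T.facetsOf K, area F.1 * ⟪A (bary F.1), mulVec G (normal K.1 F.1)⟫ =
      volume.real (body K.1) * frob (affGrad A) G := by
  have hd : (d : ℝ) ≠ 0 := Nat.cast_ne_zero.2 (NeZero.ne d)
  rw [sum_facetsOf, frob_affGrad K]
  have h1 : ∀ p : K.1, area (opp K p).1 * ⟪A (bary (opp K p).1),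
      mulVec G (normal K.1 (opp K p).1)⟫ = volume.real (body K.1) *
        (⟪A p, mulVec G (gradLam K p)⟫ - ⟪∑ q : K.1, A q, mulVec G (gradLam K p)⟫) := by
    intro p
    have hg := norm_gradLam_pos K p
    rw [area_opp, affineMap_bary_opp, normal_opp, mulVec_neg, mulVec_smul, inner_neg_right,
      inner_smul_right, inner_smul_left, inner_sub_left]
    simp only [conj_trivial]
    field_simp
    ring
  simp_rw [h1]
  rw [← Finset.mul_sum, Finset.sum_sub_distrib, ← inner_sum, ← mulVec_sum, sum_gradLam]
  have : mulVec G (0 : Vec d) = 0 := by simpa using mulVec_smul G 0 0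
  rw [this, inner_zero_right, sub_zero]

/-- The integral of the divergence of an affine field is its total flux. -/
lemma integral_dvg (K : T.Cell) (A : Vec d →ᵃ[ℝ] Vec d) (c : ℝ) :
    ∫ x in body K.1, dvg A x * c =
      (∑ F ∈ T.facetsOf K, area F.1 * ⟪A (bary F.1), normal K.1 F.1⟫) * c := by
  simp_rw [dvg_eq_frob]
  rw [integral_mul_const, integral_frob_grad, ← sum_area_inner_mulVec]
  simp_rw [mulVec_one]

/-! ### Local Raviart-Thomas and Crouzeix-Raviart fields -/

/-- The affine field on `K` with the values `m F` at the barycenters of the facets. -/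
def crLoc (K : T.Cell) (m : T.Facet → Vec d) (x : Vec d) : Vec d :=
  ∑ p : K.1, (1 - d * lam K p x) • m (opp K p)

/-- The field on `K` with the constant normal components `c F` on the facets, a combination of
the fields `x - p`, which are tangential on all facets through the vertex `p`. -/
def rtLoc (K : T.Cell) (c : T.Facet → ℝ) (x : Vec d) : Vec d :=
  ∑ p : K.1, (c (opp K p) * ‖gradLam K p‖) • (x - p)

lemma exists_affine_crLoc (K : T.Cell) (m : T.Facet → Vec d) :
    ∃ A : Vec d →ᵃ[ℝ] Vec d, crLoc K m = A := by
  refine ⟨(∑ p : K.1, -((d : ℝ) • (lam K p).linear.smulRight (m (opp K p)))).toAffineMap +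
    AffineMap.const ℝ (Vec d) (crLoc K m 0), ?_⟩
  ext1 x
  have h : ∀ p, lam K p x = (lam K p).linear x + lam K p 0 := fun p => by
    rw [← sub_eq_iff_eq_add, lam_sub, sub_zero]
  simp only [crLoc, h, AffineMap.coe_add, Pi.add_apply, LinearMap.coe_toAffineMap,
    LinearMap.sum_apply, LinearMap.neg_apply, LinearMap.smul_apply, LinearMap.smulRight_apply,
    AffineMap.const_apply]
  rw [← Finset.sum_add_distrib]
  refine Finset.sum_congr rfl fun p _ => ?_
  rw [smul_smul, ← neg_smul, ← add_smul]
  congr 1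
  ring

lemma crLoc_bary (K : T.Cell) (m : T.Facet → Vec d) {F : T.Facet} (h : F ∈ T.facetsOf K) :
    crLoc K m (bary F.1) = m F := by
  obtain ⟨p, rfl⟩ := exists_opp_eq h
  have hd : (d : ℝ) ≠ 0 := Nat.cast_ne_zero.2 (NeZero.ne d)
  rw [crLoc, Finset.sum_eq_single p]
  · simp [lam_bary_opp]
  · intro q _ hq
    simp [lam_bary_opp, hq, hd]
  · simp

/-- An affine field is determined by its values at the barycenters of the facets. -/
lemma affineMap_eq_crLoc (K : T.Cell) (A : Vec d →ᵃ[ℝ] Vec d) :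
    ⇑A = crLoc K fun F => A (bary F.1) := by
  ext1 x
  have hd : (d : ℝ) ≠ 0 := Nat.cast_ne_zero.2 (NeZero.ne d)
  have h1 : ∑ p : K.1, (1 - d * lam K p x) = 1 := by
    rw [Finset.sum_sub_distrib, ← Finset.mul_sum, sum_lam]
    simp [K.2.2]
  simp_rw [crLoc, affineMap_bary_opp, smul_smul, smul_sub]
  rw [Finset.sum_sub_distrib, ← Finset.sum_smul, ← Finset.sum_mul, h1, one_mul]
  have h2 : ∑ p : K.1, ((1 - d * lam K p x) * (d : ℝ)⁻¹) • A p =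
      (d : ℝ)⁻¹ • ∑ p : K.1, A p - A x := by
    rw [affineMap_eq_sum_lam K A x, Finset.smul_sum, ← Finset.sum_sub_distrib]
    refine Finset.sum_congr rfl fun p _ => ?_
    rw [← sub_smul]
    congr 1
    field_simp
  rw [h2]
  abel

lemma crLoc_congr (K : T.Cell) {m m' : T.Facet → Vec d} (h : ∀ F ∈ T.facetsOf K, m F = m' F) :
    crLoc K m = crLoc K m' := by
  ext1 x
  exact Finset.sum_congr rfl fun p _ => by rw [h _ (opp_mem K p)]

lemma rtLoc_congr (K : T.Cell) {c c' : T.Facet → ℝ} (h : ∀ F ∈ T.facetsOf K, c F = c' F) :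
    rtLoc K c = rtLoc K c' := by
  ext1 x
  exact Finset.sum_congr rfl fun p _ => by rw [h _ (opp_mem K p)]

lemma exists_rtLoc_eq (K : T.Cell) (c : T.Facet → ℝ) :
    ∃ (a : Vec d) (b : ℝ), ∀ x, rtLoc K c x = a + b • x := by
  refine ⟨-∑ p : K.1, (c (opp K p) * ‖gradLam K p‖) • (p : Vec d),
    ∑ p : K.1, c (opp K p) * ‖gradLam K p‖, fun x => ?_⟩
  simp_rw [rtLoc, smul_sub]
  rw [Finset.sum_sub_distrib, ← Finset.sum_smul]
  abel

lemma inner_normal_opp (K : T.Cell) (p : K.1) (x y : Vec d) :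
    ⟪x - y, normal K.1 (opp K p).1⟫ = ‖gradLam K p‖⁻¹ * (lam K p y - lam K p x) := by
  rw [normal_opp, inner_neg_right, inner_smul_right, real_inner_comm, ← lam_sub_eq_inner]
  ring

/-- A facet lies in a hyperplane orthogonal to its normal. -/
lemma inner_normal_sub_eq_zero {K : T.Cell} {F : T.Facet} (h : F ∈ T.facetsOf K) {x y : Vec d}
    (hx : x ∈ body F.1) (hy : y ∈ body F.1) : ⟪x - y, normal K.1 F.1⟫ = 0 := by
  obtain ⟨p, rfl⟩ := exists_opp_eq h
  rw [inner_normal_opp, (mem_body_opp.1 hx).2, (mem_body_opp.1 hy).2, sub_zero, mul_zero]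

lemma inner_rtLoc_normal {K : T.Cell} (c : T.Facet → ℝ) {F : T.Facet} (h : F ∈ T.facetsOf K)
    {x : Vec d} (hx : x ∈ body F.1) : ⟪rtLoc K c x, normal K.1 F.1⟫ = c F := by
  obtain ⟨p, rfl⟩ := exists_opp_eq h
  have hg := norm_gradLam_pos K p
  rw [rtLoc, sum_inner, Finset.sum_eq_single p]
  · rw [inner_smul_left, inner_normal_opp, (mem_body_opp.1 hx).2, lam_self]
    simp only [conj_trivial]
    field_simp
    ring
  · intro q _ hq
    rw [inner_smul_left, inner_normal_opp, (mem_body_opp.1 hx).2, lam_ne K hq.symm]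
    simp
  · simp

/-- The normal components of a Raviart-Thomas field are constant on the facets. -/
lemma inner_normal_eq_bary {K : T.Cell} {v : Vec d → Vec d}
    (hv : ∃ (a : Vec d) (b : ℝ), ∀ x, v x = a + b • x) {F : T.Facet} (h : F ∈ T.facetsOf K)
    {x : Vec d} (hx : x ∈ body F.1) :
    ⟪v x, normal K.1 F.1⟫ = ⟪v (bary F.1), normal K.1 F.1⟫ := by
  obtain ⟨a, b, hv⟩ := hv
  have := inner_normal_sub_eq_zero h hx (bary_mem_body F)
  rw [inner_sub_left, sub_eq_zero] at this
  simp only [hv, inner_add_left, inner_smul_left, this]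

/-- A local Raviart-Thomas field is determined by its normal components. -/
lemma eq_rtLoc (K : T.Cell) {v : Vec d → Vec d}
    (hv : ∃ (a : Vec d) (b : ℝ), ∀ x, v x = a + b • x) :
    v = rtLoc K fun F => ⟪v (bary F.1), normal K.1 F.1⟫ := by
  obtain ⟨a, b, hv⟩ := hv
  have hw : ∀ p : K.1, ⟪v (bary (opp K p).1), normal K.1 (opp K p).1⟫ * ‖gradLam K p‖ =
      b * lam K p 0 - ⟪gradLam K p, a⟫ := by
    intro p
    have hg := norm_gradLam_pos K p
    have h0 := lam_sub_eq_inner K p (bary (opp K p).1) 0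
    rw [lam_bary_opp, if_pos rfl, sub_zero] at h0
    rw [hv, normal_opp, inner_neg_right, inner_smul_right, real_inner_comm, inner_add_right,
      inner_smul_right, ← h0]
    field_simp
    ring
  ext1 x
  have h1 : ∑ p : K.1, (b * lam K p 0 - ⟪gradLam K p, a⟫) = b := by
    rw [Finset.sum_sub_distrib, ← Finset.mul_sum, sum_lam, ← sum_inner, sum_gradLam,
      inner_zero_left]
    ring
  have h2 : ∑ p : K.1, (b * lam K p 0 - ⟪gradLam K p, a⟫) • (p : Vec d) = -a := by
    have h3 := sum_lam_smul K 0
    have h4 := sum_lam_smul K (0 + a)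
    simp_rw [lam_add, add_smul] at h4
    rw [Finset.sum_add_distrib, h3, zero_add, zero_add] at h4
    simp_rw [sub_smul, mul_smul]
    rw [Finset.sum_sub_distrib, ← Finset.smul_sum, h3, h4, smul_zero, zero_sub]
  simp_rw [rtLoc, hw, smul_sub]
  rw [Finset.sum_sub_distrib, ← Finset.sum_smul, h1, h2, hv, sub_neg_eq_add, add_comm]

/-- The divergence theorem for the product of a local Raviart-Thomas field and a function. -/
lemma integral_fderiv_add_div (K : T.Cell) {v : Vec d → Vec d} {a : Vec d} {b : ℝ}
    (hv : ∀ x, v x = a + b • x) {φ : Vec d → ℝ} (hφ : ContDiff ℝ 1 φ) :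
    ∫ x in body K.1, (fderiv ℝ φ x (v x) + d * b * φ x) =
      ∑ F ∈ T.facetsOf K, ⟪v (bary F.1), normal K.1 F.1⟫ * facetInt F.1 φ := by
  have hφ' : Continuous (fderiv ℝ φ) := hφ.continuous_fderiv one_ne_zero
  have hcφ : Continuous φ := hφ.continuous
  set w : K.1 → ℝ := fun p => ⟪v (bary (opp K p).1), normal K.1 (opp K p).1⟫ * ‖gradLam K p‖
    with hwdef
  have hvw : ∀ x, v x = ∑ p : K.1, w p • (x - p) := fun x => congrFun (eq_rtLoc K ⟨a, b, hv⟩) x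
  have hb : b = ∑ p : K.1, w p := by
    obtain ⟨y, hy⟩ := exists_ne (0 : Vec d)
    have h1 : v y - v 0 = b • y := by rw [hv, hv]; simp
    have h2 : v y - v 0 = (∑ p : K.1, w p) • y := by
      rw [hvw, hvw, ← Finset.sum_sub_distrib, Finset.sum_smul]
      exact Finset.sum_congr rfl fun p _ => by rw [← smul_sub, sub_sub_sub_cancel_right, sub_zero]
    exact smul_left_injective ℝ hy (h1.symm.trans h2)
  have h1 : ∀ x, fderiv ℝ φ x (v x) + d * b * φ x =
      ∑ p : K.1, w p * (d * φ x + fderiv ℝ φ x (x - p)) := by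
    intro x
    rw [hvw, map_sum, hb]
    simp_rw [map_smul, smul_eq_mul, mul_add]
    rw [Finset.sum_add_distrib, Finset.mul_sum, Finset.sum_mul, add_comm]
    congr 1
    exact Finset.sum_congr rfl fun p _ => by ring
  have hi : ∀ p : K.1, Integrable (fun x => d * φ x + fderiv ℝ φ x (x - p))
      (volume.restrict (body K.1)) := fun p => integrableOn_cell K (by fun_prop)
  simp_rw [h1]
  rw [integral_finsetSum _ fun p _ => (hi p).const_mul _, sum_facetsOf]
  refine Finset.sum_congr rfl fun p _ => ?_
  have hg := norm_gradLam_pos K p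
  rw [integral_const_mul, cone_formula K p hφ, hwdef]
  field_simp

end

section

/-! ### Elements and facets inside the domain -/

/-- If a point of the face `s` has positive barycentric coordinates at the vertices of `t` then `t`
is a part of `s`. -/
lemma subset_of_lam_pos {K : T.Cell} {s t : Finset (Vec d)} (hs : s ∈ T.faces) (ht : t ⊆ K.1)
    {x : Vec d} (hx : x ∈ body K.1) (hpos : ∀ p : K.1, (p : Vec d) ∈ t → 0 < lam K p x)
    (hxs : x ∈ body s) : t ⊆ s := by
  intro p hp
  by_contra hps
  have h : x ∈ body (K.1 ∩ s) := by
    have := T.inter_subset_convexHull K.2.1 hs ⟨hx, hxs⟩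
    rwa [← Finset.coe_inter] at this
  have h0 := ((mem_body_iff K Finset.inter_subset_left).1 h ⟨p, ht hp⟩).2
    fun h => hps (Finset.mem_inter.1 h).2
  exact (hpos ⟨p, ht hp⟩ hp).ne' h0

lemma subset_of_mem_interior {K : T.Cell} {s : Finset (Vec d)} (hs : s ∈ T.faces) {x : Vec d}
    (hx : x ∈ interior (body K.1)) (hxs : x ∈ body s) : K.1 ⊆ s := by
  have h := hx
  rw [interior_cell] at h
  exact subset_of_lam_pos hs subset_rfl (interior_subset hx) (fun p _ => h p) hxs

lemma cell_eq_of_mem_interior {K K' : T.Cell} {x : Vec d} (hx : x ∈ interior (body K.1))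
    (hx' : x ∈ body K'.1) : K = K' :=
  Subtype.ext (Finset.eq_of_subset_of_card_le (subset_of_mem_interior K'.2.1 hx hx')
    (by rw [K.2.2, K'.2.2]))

lemma cell_subset_closure (hT : T.Triangulates Ω) (K : T.Cell) : body K.1 ⊆ closure Ω := by
  rw [← hT.iUnion_cell]
  exact Set.subset_iUnion (fun K : T.Cell => body K.1) K

lemma interior_cell_subset (hΩ : IsOpen Ω) (hT : T.Triangulates Ω) (K : T.Cell) :
    interior (body K.1) ⊆ Ω := by
  intro x hx
  by_contra hxΩ
  have hf : x ∈ frontier Ω := by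
    rw [frontier, hΩ.interior_eq]
    exact ⟨cell_subset_closure hT K (interior_subset hx), hxΩ⟩
  rw [← hT.iUnion_boundary] at hf
  simp only [Set.mem_iUnion] at hf
  obtain ⟨F, -, hxF⟩ := hf
  have := Finset.card_le_card (subset_of_mem_interior F.2.1 hx hxF)
  rw [K.2.2, F.2.2] at this
  omega

lemma interior_cell_ae_eq (K : T.Cell) : interior (body K.1) =ᵐ[volume] body K.1 :=
  interior_ae_eq_of_null_frontier ((convex_body K.1).addHaar_frontier volume)

lemma domain_ae_eq (hΩ : IsOpen Ω) (hT : T.Triangulates Ω) :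
    Ω =ᵐ[volume] ⋃ K : T.Cell, body K.1 := by
  refine Filter.EventuallyLE.antisymm ?_ ?_
  · refine (show Ω ⊆ ⋃ K : T.Cell, body K.1 from ?_).eventuallyLE
    rw [hT.iUnion_cell]
    exact subset_closure
  · have h : (⋃ K : T.Cell, body K.1) =ᵐ[volume] ⋃ K : T.Cell, interior (body K.1) :=
      Filter.EventuallyEq.countable_iUnion fun K => (interior_cell_ae_eq K).symm
    exact h.le.trans (Set.iUnion_subset fun K => interior_cell_subset hΩ hT K).eventuallyLE

lemma aedisjoint_cells :
    Pairwise (Function.onFun (AEDisjoint volume) fun K : T.Cell => body K.1) := by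
  intro K K' hne
  refine measure_mono_null ?_ ((convex_body K.1).addHaar_frontier volume)
  rintro x ⟨hx, hx'⟩
  refine ⟨subset_closure hx, fun hi => hne (cell_eq_of_mem_interior hi hx')⟩

lemma measure_domain_lt_top (hT : T.Triangulates Ω) : volume Ω < ⊤ := by
  refine (measure_mono (subset_closure.trans hT.iUnion_cell.symm.subset)).trans_lt ?_
  exact (isCompact_iUnion fun K : T.Cell => isCompact_body K.1).measure_lt_top

lemma restrict_domain (hΩ : IsOpen Ω) (hT : T.Triangulates Ω) :
    volume.restrict Ω = volume.restrict (⋃ K : T.Cell, body K.1) :=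
  Measure.restrict_congr_set (domain_ae_eq hΩ hT)

lemma ae_cell_of_ae_domain (hΩ : IsOpen Ω) (hT : T.Triangulates Ω) {P : Vec d → Prop}
    (h : ∀ᵐ x ∂(volume.restrict Ω), P x) (K : T.Cell) :
    ∀ᵐ x ∂(volume.restrict (body K.1)), P x := by
  rw [restrict_domain hΩ hT] at h
  exact ae_restrict_of_ae_restrict_of_subset (Set.subset_iUnion (fun K : T.Cell => body K.1) K) h

/-- Integration over the domain, element by element. -/
lemma integral_domain (hΩ : IsOpen Ω) (hT : T.Triangulates Ω) {g : Vec d → ℝ}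
    {gK : T.Cell → Vec d → ℝ} (hg : ∀ K, ∀ x ∈ interior (body K.1), g x = gK K x)
    (hi : ∀ K, IntegrableOn (gK K) (body K.1)) :
    IntegrableOn g Ω ∧ ∫ x in Ω, g x = ∑ K : T.Cell, ∫ x in body K.1, gK K x := by
  have hae : ∀ K : T.Cell, g =ᵐ[volume.restrict (body K.1)] gK K := by
    intro K
    rw [← Measure.restrict_congr_set (interior_cell_ae_eq K)]
    exact (ae_restrict_iff' isOpen_interior.measurableSet).2 (Filter.Eventually.of_forall (hg K))
  have hi' : IntegrableOn g (⋃ K : T.Cell, body K.1) volume := by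
    rw [integrableOn_finite_iUnion]
    exact fun K => (hi K).congr (hae K).symm
  refine ⟨?_, ?_⟩
  · rw [IntegrableOn, restrict_domain hΩ hT]
    exact hi'
  · have h := integral_iUnion_ae (μ := volume) (s := fun K : T.Cell => body K.1)
      (fun K => (isClosed_body K.1).measurableSet.nullMeasurableSet) aedisjoint_cells hi'
    rw [restrict_domain hΩ hT, h, tsum_fintype]
    exact Finset.sum_congr rfl fun K _ => integral_congr_ae (hae K)

lemma assemble_eq {M : Type*} [AddCommMonoid M] (v : T.Cell → Vec d → M) {K : T.Cell} {x : Vec d}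
    (hx : x ∈ interior (body K.1)) : assemble T v x = v K x := by
  rw [assemble, Finset.sum_eq_single K, Set.indicator_of_mem hx]
  · intro K' _ hne
    exact Set.indicator_of_notMem
      (fun h => hne (cell_eq_of_mem_interior h (interior_subset hx))) _
  · simp

lemma memLp_assemble {E : Type*} [NormedAddCommGroup E] {v : T.Cell → Vec d → E}
    (hv : ∀ K, Continuous (v K)) : MemLp (assemble T v) 2 (volume.restrict Ω) := by
  have : assemble T v = ∑ K : T.Cell, (interior (body K.1)).indicator (v K) := by
    ext1 x; simp [assemble]
  rw [this]
  refine memLp_finsetSum' _ fun K _ => ?_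
  refine MemLp.restrict Ω ?_
  rw [memLp_indicator_iff_restrict isOpen_interior.measurableSet]
  obtain ⟨C, hC⟩ := (isCompact_body K.1).exists_bound_of_continuousOn (hv K).continuousOn
  have hfin : IsFiniteMeasure (volume.restrict (interior (body K.1))) :=
    ⟨by rw [Measure.restrict_apply_univ]
        exact (measure_mono interior_subset).trans_lt (isCompact_body K.1).measure_lt_top⟩
  refine MemLp.of_bound ?_ C ?_
  · have := (hv K).continuousOn.aestronglyMeasurable (μ := volume) isOpen_interior.measurableSet
      (s := interior (body K.1))
    exact this
  · exact (ae_restrict_iff' isOpen_interior.measurableSet).2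
      (Filter.Eventually.of_forall fun x hx => hC x (interior_subset hx))

/-! ### The normal continuity of piecewise Raviart-Thomas fields -/

/-- The sum of the outward normal components of the piecewise field `v` on the two sides of a
facet. -/
def jump (v : T.Cell → Vec d → Vec d) (F : T.Facet) : ℝ :=
  ∑ K : T.Cell with F ∈ T.facetsOf K, ⟪v K (bary F.1), normal K.1 F.1⟫

lemma sum_cells_facets {M : Type*} [AddCommMonoid M] (g : T.Cell → T.Facet → M) :
    ∑ K : T.Cell, ∑ F ∈ T.facetsOf K, g K F =
      ∑ F : T.Facet, ∑ K : T.Cell with F ∈ T.facetsOf K, g K F :=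
  Finset.sum_comm' (by simp)

lemma facetInt_eq_zero {F : Finset (Vec d)} {φ : Vec d → ℝ} (h : ∀ x ∈ body F, φ x = 0) :
    facetInt F φ = 0 := by
  rw [facetInt_congr (g := fun _ => 0) h, facetInt_const, zero_mul]

variable [NeZero d]

/-- The divergence theorem for a piecewise Raviart-Thomas field `v` tested with `φ`: up to the
elementwise divergence, only the normal jumps contribute. -/
lemma integral_fderiv_assemble (hΩ : IsOpen Ω) (hT : T.Triangulates Ω)
    {v : T.Cell → Vec d → Vec d} {a : T.Cell → Vec d} {b : T.Cell → ℝ}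
    (hv : ∀ K x, v K x = a K + b K • x) {φ : Vec d → ℝ} (hφ : ContDiff ℝ 1 φ) :
    (∫ x in Ω, fderiv ℝ φ x (assemble T v x)) +
      ∫ x in Ω, assemble T (fun K _ => d * b K) x * φ x =
      ∑ F : T.Facet, jump v F * facetInt F.1 φ := by
  have hφ' : Continuous (fderiv ℝ φ) := hφ.continuous_fderiv one_ne_zero
  have hcφ : Continuous φ := hφ.continuous
  have hcv : ∀ K, Continuous (v K) := fun K => by
    rw [show v K = fun x => a K + b K • x from funext (hv K)]; fun_prop
  have hi1 : ∀ K : T.Cell, IntegrableOn (fun x => fderiv ℝ φ x (v K x)) (body K.1) := fun K =>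
    integrableOn_cell K (hφ'.clm_apply (hcv K))
  have hi2 : ∀ K : T.Cell, IntegrableOn (fun x => d * b K * φ x) (body K.1) := fun K =>
    integrableOn_cell K (by fun_prop)
  rw [(integral_domain hΩ hT (fun K x hx => by rw [assemble_eq v hx]) hi1).2,
    (integral_domain hΩ hT (fun K x hx => by rw [assemble_eq _ hx]) hi2).2,
    ← Finset.sum_add_distrib]
  simp_rw [jump, Finset.sum_mul]
  rw [← sum_cells_facets (fun (K : T.Cell) (F : T.Facet) =>
    ⟪v K (bary F.1), normal K.1 F.1⟫ * facetInt F.1 φ)]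
  refine Finset.sum_congr rfl fun K _ => ?_
  rw [← integral_add (hi1 K) (hi2 K), integral_fderiv_add_div K (hv K) hφ]

/-- A piecewise Raviart-Thomas field without normal jumps has a weak divergence. -/
lemma memHDiv_of_jump_eq_zero (hΩ : IsOpen Ω) (hT : T.Triangulates Ω)
    {v : T.Cell → Vec d → Vec d} (hv : ∀ K, ∃ (a : Vec d) (b : ℝ), ∀ x, v K x = a + b • x)
    (hj : ∀ F : T.Facet, ¬ T.IsBoundary Ω F → jump v F = 0) : MemHDiv Ω (assemble T v) := by
  choose a b hv using hv
  have hcv : ∀ K, Continuous (v K) := fun K => by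
    rw [show v K = fun x => a K + b K • x from funext (hv K)]; fun_prop
  refine ⟨memLp_assemble hcv, assemble T (fun K _ => d * b K),
    memLp_assemble fun K => continuous_const, fun φ hφ _ hs => ?_⟩
  have h := integral_fderiv_assemble hΩ hT hv (hφ.of_le (by exact_mod_cast le_top))
  rw [Finset.sum_eq_zero fun F _ => ?_] at h
  · linarith
  · by_cases hF : T.IsBoundary Ω F
    · rw [facetInt_eq_zero fun x hx => ?_, mul_zero]
      have hx' := hF hx
      rw [frontier, hΩ.interior_eq] at hx'
      exact image_eq_zero_of_notMem_tsupport fun h => hx'.2 (hs h)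
    · rw [hj F hF, zero_mul]

end

section

/-! ### Connectedness of the mesh -/

lemma affineSpan_insert_ne_top (y : Vec d) {s : Finset (Vec d)} (hne : s.Nonempty)
    (hs : s.card < d) :
    affineSpan ℝ (insert y (s : Set (Vec d))) ≠ ⊤ := by
  intro h
  have h1 : vectorSpan ℝ (insert y (s : Set (Vec d))) = ⊤ := by
    rw [← direction_affineSpan, h, AffineSubspace.direction_top]
  have h2 := finrank_vectorSpan_insert_le_set ℝ (s : Set (Vec d)) y
  rw [h1, finrank_top, finrank_euclideanSpace_fin] at h2
  have h3 := finrank_vectorSpan_image_finset_le ℝ (id : Vec d → Vec d) s (n := s.card - 1)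
    (by have := hne.card_pos; omega)
  rw [Finset.image_id] at h3
  have := hne.card_pos
  omega

/-- In a connected domain any two elements are connected by a chain of elements with common facets
inside the domain: a generic segment between two elements avoids the faces of codimension two. -/
lemma eq_univ_of_adjacent (hΩ : IsOpen Ω) (hΩc : IsConnected Ω) (hT : T.Triangulates Ω)
    {C : Set T.Cell} (hC : C.Nonempty)
    (hadj : ∀ K ∈ C, ∀ K' : T.Cell, ∀ F : T.Facet, ¬ T.IsBoundary Ω F → F ∈ T.facetsOf K →
      F ∈ T.facetsOf K' → K' ∈ C) : C = Set.univ := by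
  by_contra hCu
  obtain ⟨K₁, hK₁⟩ := hC
  obtain ⟨K₂, hK₂⟩ := (Set.ne_univ_iff_exists_notMem C).1 hCu
  let A : Set (Vec d) := ⋃ K ∈ C, body K.1
  let B : Set (Vec d) := ⋃ K ∈ Cᶜ, body K.1
  have hA : IsClosed A := (Set.toFinite C).isClosed_biUnion fun K _ => isClosed_body K.1
  have hB : IsClosed B := (Set.toFinite Cᶜ).isClosed_biUnion fun K _ => isClosed_body K.1
  have hcov : Ω ⊆ A ∪ B := by
    intro x hx
    have hx' := subset_closure hx
    rw [← hT.iUnion_cell] at hx'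
    obtain ⟨K, hK⟩ := Set.mem_iUnion.1 hx'
    by_cases hKC : K ∈ C
    · exact Or.inl (Set.mem_biUnion hKC hK)
    · exact Or.inr (Set.mem_biUnion hKC hK)
  have hint : ∀ K : T.Cell, bary K.1 ∈ Ω ∧ bary K.1 ∈ body K.1 := fun K =>
    ⟨interior_cell_subset hΩ hT K (bary_mem_interior K), interior_subset (bary_mem_interior K)⟩
  obtain ⟨x, hxΩ, hxA, hxB⟩ := isPreconnected_closed_iff.1 hΩc.isPreconnected A B hA hB hcov
    ⟨_, (hint K₁).1, Set.mem_biUnion hK₁ (hint K₁).2⟩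
    ⟨_, (hint K₂).1, Set.mem_biUnion (show K₂ ∈ Cᶜ from hK₂) (hint K₂).2⟩
  obtain ⟨K, hKC, hxK⟩ := Set.mem_iUnion₂.1 hxA
  obtain ⟨K', hKC', hxK'⟩ := Set.mem_iUnion₂.1 hxB
  obtain ⟨r, hr, hball⟩ := Metric.isOpen_iff.1 hΩ x hxΩ
  obtain ⟨y, hyb, hyK⟩ := mem_closure_iff.1 (cell_subset_closure_interior K hxK) _
    Metric.isOpen_ball (Metric.mem_ball_self hr)
  -- a second point in general position with respect to the first
  obtain ⟨y', ⟨hyb', hyK'⟩, hgen⟩ : ∃ y' ∈ Metric.ball x r ∩ interior (body K'.1),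
      ∀ s ∈ T.faces, s.card < d → y' ∉ affineSpan ℝ (insert y (s : Set (Vec d))) := by
    have hopen : IsOpen (Metric.ball x r ∩ interior (body K'.1)) :=
      Metric.isOpen_ball.inter isOpen_interior
    have hpos := hopen.measure_pos volume (mem_closure_iff.1
      (cell_subset_closure_interior K' hxK') _ Metric.isOpen_ball (Metric.mem_ball_self hr))
    have hnull : volume (⋃ s ∈ {s ∈ T.faces | s.card < d},
        (affineSpan ℝ (insert y (s : Set (Vec d))) : Set (Vec d))) = 0 := by
      refine (measure_biUnion_null_iff (T.finite_faces.subset fun s hs => hs.1).countable).2 ?_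
      exact fun s hs => Measure.addHaar_affineSubspace _ _
        (affineSpan_insert_ne_top y (T.nonempty_of_mem_faces hs.1) hs.2)
    obtain ⟨y', hy', hn⟩ := Set.not_subset.1 fun hsub =>
      hpos.ne' (measure_mono_null hsub hnull)
    refine ⟨y', hy', fun s hs hc hmem => hn (Set.mem_biUnion ⟨hs, hc⟩ hmem)⟩
  have hseg : segment ℝ y y' ⊆ Ω :=
    ((convex_ball x r).segment_subset hyb hyb').trans hball
  obtain ⟨z, hz, hzA, hzB⟩ := isPreconnected_closed_iff.1
    (convex_segment (𝕜 := ℝ) y y').isPreconnected A B hA hB (hseg.trans hcov)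
    ⟨y, left_mem_segment ℝ y y', Set.mem_biUnion hKC (interior_subset hyK)⟩
    ⟨y', right_mem_segment ℝ y y', Set.mem_biUnion hKC' (interior_subset hyK')⟩
  obtain ⟨J, hJC, hzJ⟩ := Set.mem_iUnion₂.1 hzA
  obtain ⟨J', hJC', hzJ'⟩ := Set.mem_iUnion₂.1 hzB
  have hzE : z ∈ body (J.1 ∩ J'.1) := by
    have := T.inter_subset_convexHull J.2.1 J'.2.1 ⟨hzJ, hzJ'⟩
    rwa [← Finset.coe_inter] at this
  have hEne : (J.1 ∩ J'.1).Nonempty := by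
    have := convexHull_nonempty_iff.1 ⟨z, hzE⟩
    exact_mod_cast this
  have hEf : J.1 ∩ J'.1 ∈ T.faces := T.down_closed J.2.1 Finset.inter_subset_left hEne
  have hEc : (J.1 ∩ J'.1).card < d + 1 := by
    by_contra h
    push Not at h
    have h1 := Finset.eq_of_subset_of_card_le (Finset.inter_subset_left (s₁ := J.1) (s₂ := J'.1))
      (by rw [J.2.2]; exact h)
    have h2 := Finset.eq_of_subset_of_card_le (Finset.inter_subset_right (s₁ := J.1) (s₂ := J'.1))
      (by rw [J'.2.2]; exact h)
    exact hJC' (by rwa [← Subtype.ext (h1.symm.trans h2)])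
  rcases Nat.lt_succ_iff_lt_or_eq.1 hEc with hlt | heq
  · by_cases hzy : z = y
    · have := Finset.card_le_card (subset_of_mem_interior hEf hyK (hzy ▸ hzE))
      rw [K.2.2] at this
      omega
    · refine hgen _ hEf hlt ?_
      rw [segment_eq_image_lineMap] at hz
      obtain ⟨t, -, rfl⟩ := hz
      have ht : t ≠ 0 := by
        rintro rfl
        exact hzy (AffineMap.lineMap_apply_zero _ _)
      have hzS : AffineMap.lineMap y y' t ∈
          affineSpan ℝ (insert y ((J.1 ∩ J'.1 : Finset (Vec d)) : Set (Vec d))) :=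
        affineSpan_mono ℝ (Set.subset_insert _ _) (convexHull_subset_affineSpan _ hzE)
      have hyS : y ∈ affineSpan ℝ (insert y ((J.1 ∩ J'.1 : Finset (Vec d)) : Set (Vec d))) :=
        subset_affineSpan ℝ _ (Set.mem_insert _ _)
      have := AffineMap.lineMap_mem t⁻¹ hyS hzS
      rwa [AffineMap.lineMap_lineMap_right, inv_mul_cancel₀ ht, AffineMap.lineMap_apply_one] at this
  · refine hJC' (hadj J hJC J' ⟨J.1 ∩ J'.1, hEf, heq⟩ (fun hb => ?_)
      (mem_facetsOf.2 Finset.inter_subset_left) (mem_facetsOf.2 Finset.inter_subset_right))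
    have := hb hzE
    rw [frontier, hΩ.interior_eq] at this
    exact this.2 (hseg hz)

/-! ### Normal jumps and weak divergences -/

lemma exists_cell_of_facet (F : T.Facet) : ∃ K : T.Cell, F ∈ T.facetsOf K := by
  obtain ⟨K, hK, hF, hc⟩ := T.exists_cell F.1 F.2.1
  exact ⟨⟨K, hK, hc⟩, mem_facetsOf.2 hF⟩

variable [NeZero d]

/-- A facet that is not contained in the boundary has a point in its relative interior that belongs
to the domain. -/
lemma exists_mem_relint_facet (hΩ : IsOpen Ω) (hT : T.Triangulates Ω) {K : T.Cell} {p : K.1}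
    (hF : ¬ T.IsBoundary Ω (opp K p)) :
    ∃ x ∈ Ω, x ∈ body (opp K p).1 ∧ ∀ q : K.1, q ≠ p → 0 < lam K q x := by
  obtain ⟨y, hy, hyf⟩ := Set.not_subset.1 hF
  have hyΩ : y ∈ Ω := by
    by_contra h
    refine hyf ?_
    rw [frontier, hΩ.interior_eq]
    exact ⟨cell_subset_closure hT K (mem_body_opp.1 hy).1, h⟩
  set c := bary (opp K p).1 with hc
  have hcont : Continuous fun t : ℝ => y + t • (c - y) := by fun_prop
  have hev : ∀ᶠ t in nhdsWithin (0 : ℝ) (Set.Ioi 0), y + t • (c - y) ∈ Ω := by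
    refine nhdsWithin_le_nhds (hcont.continuousAt.eventually_mem (hΩ.mem_nhds ?_))
    simpa using hyΩ
  obtain ⟨t, ht, ht0, ht1⟩ := (hev.and (Ioo_mem_nhdsGT one_pos)).exists
  refine ⟨_, ht, (convex_body _).add_smul_sub_mem hy (bary_mem_body _) ⟨ht0.le, ht1.le⟩,
    fun q hq => ?_⟩
  rw [lam_add, inner_smul_right, ← lam_sub_eq_inner, hc, lam_bary_opp, if_neg hq]
  have h1 : 0 ≤ lam K q y := by
    have := (mem_body_opp.1 hy).1
    rw [body_cell] at this
    exact this q
  have h2 : 0 < (d : ℝ)⁻¹ := inv_pos.2 (Nat.cast_pos.2 (NeZero.pos d))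
  nlinarith [mul_pos ht0 h2, mul_nonneg (sub_pos.2 ht1).le h1]

/-- A nonnegative continuous function that is positive at a relatively interior point of a facet
has a positive integral. -/
lemma facetInt_pos {K : T.Cell} {p : K.1} {x : Vec d} (hx : x ∈ body (opp K p).1)
    (hpos : ∀ q : K.1, q ≠ p → 0 < lam K q x) {φ : Vec d → ℝ} (hφ : Continuous φ)
    (h0 : ∀ y, 0 ≤ φ y) (hφx : 0 < φ x) : 0 < facetInt (opp K p).1 φ := by
  obtain ⟨z, rfl⟩ := range_facetChart K p hx
  have hch : Continuous (facetChart K p) := (isometry_facetChart K p).continuous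
  rw [facetInt_eq_integral_chart, setIntegral_pos_iff_support_of_nonneg_ae
    (Filter.Eventually.of_forall fun _ => h0 _)
    ((hφ.comp hch).continuousOn.integrableOn_compact (isCompact_preimage_facetChart K p))]
  let U : Set (vectorSpan ℝ ((opp K p).1 : Set (Vec d))) :=
    {w | 0 < φ (facetChart K p w)} ∩ ⋂ q : K.1, {w | q ≠ p → 0 < lam K q (facetChart K p w)}
  have hU : IsOpen U := by
    refine (isOpen_lt continuous_const (hφ.comp hch)).inter (isOpen_iInter_of_finite fun q => ?_)
    by_cases hq : q = p
    · simp [hq]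
    · simpa [hq] using isOpen_lt continuous_const ((continuous_lam K q).comp hch)
  have hzU : z ∈ U := ⟨hφx, Set.mem_iInter.2 fun q => hpos q⟩
  refine (hU.measure_pos volume ⟨z, hzU⟩).trans_le (measure_mono ?_)
  rintro w ⟨hw1, hw2⟩
  rw [Set.mem_iInter] at hw2
  have hp : lam K p (facetChart K p w) = 0 := by
    have := lam_cone K p w 1
    rw [mul_one, add_assoc, sub_self] at this
    exact this
  refine ⟨ne_of_gt hw1, mem_body_opp.2 ⟨?_, hp⟩⟩
  rw [body_cell]
  intro q
  by_cases hq : q = p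
  · rw [hq, hp]
  · exact (hw2 q hq).le

lemma volume_facet (F : T.Facet) : volume (body F.1) = 0 := by
  obtain ⟨K, hK⟩ := exists_cell_of_facet F
  obtain ⟨p, rfl⟩ := exists_opp_eq hK
  refine measure_mono_null ?_ ((convex_body K.1).addHaar_frontier volume)
  intro x hx
  obtain ⟨h1, h2⟩ := mem_body_opp.1 hx
  refine ⟨subset_closure h1, fun hi => ?_⟩
  rw [interior_cell] at hi
  exact (hi p).ne' h2

/-- A piecewise Raviart-Thomas field with a weak divergence has no normal jumps. Tested with
functions supported near a point of the facet, the weak divergence is first identified off the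
facet; a bump function then isolates the jump. -/
lemma jump_eq_zero_of_memHDiv (hΩ : IsOpen Ω) (hT : T.Triangulates Ω)
    {v : T.Cell → Vec d → Vec d} (hv : ∀ K, ∃ (a : Vec d) (b : ℝ), ∀ x, v K x = a + b • x)
    (hdiv : MemHDiv Ω (assemble T v)) {F : T.Facet} (hF : ¬ T.IsBoundary Ω F) : jump v F = 0 := by
  choose a b hv using hv
  obtain ⟨-, g, hg, hgv⟩ := hdiv
  obtain ⟨K, hK⟩ := exists_cell_of_facet F
  obtain ⟨p, rfl⟩ := exists_opp_eq hK
  obtain ⟨x₀, hx₀Ω, hx₀F, hx₀⟩ := exists_mem_relint_facet hΩ hT hF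
  set F := opp K p with hFdef
  have : IsFiniteMeasure (volume.restrict Ω) :=
    ⟨by rw [Measure.restrict_apply_univ]; exact measure_domain_lt_top hT⟩
  let D : Vec d → ℝ := assemble T (fun K _ => d * b K)
  have hD : MemLp D 2 (volume.restrict Ω) := memLp_assemble fun K => continuous_const
  -- the part of `Ω` away from the other facets
  let U : Set (Vec d) := Ω ∩ ⋂ E : T.Facet, {x | E ≠ F → x ∉ body E.1}
  have hU : IsOpen U := by
    refine hΩ.inter (isOpen_iInter_of_finite fun E => ?_)
    by_cases hE : E = F
    · simp [hE]
    · have : {x | E ≠ F → x ∉ body E.1} = (body E.1)ᶜ := by ext x; simp [hE]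
      rw [this]
      exact (isClosed_body E.1).isOpen_compl
  have hx₀U : x₀ ∈ U := by
    refine ⟨hx₀Ω, Set.mem_iInter.2 fun E hE hxE => hE ?_⟩
    refine Subtype.ext (Finset.eq_of_subset_of_card_le (subset_of_lam_pos E.2.1
      (mem_facetsOf.1 hK) (mem_body_opp.1 hx₀F).1 (fun q hq => hx₀ q ?_) hxE) ?_).symm
    · rintro rfl
      simp [hFdef, opp_val] at hq
    · rw [E.2.2, F.2.2]
  have hDi : Integrable (D - g) (volume.restrict Ω) :=
    (hD.sub hg).integrable one_le_two
  have key : ∀ φ : Vec d → ℝ, ContDiff ℝ ∞ φ → HasCompactSupport φ → tsupport φ ⊆ U →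
      ∫ x in Ω, φ x • (D - g) x = jump v F * facetInt F.1 φ := by
    intro φ hφ hφc hφs
    have h1 := integral_fderiv_assemble hΩ hT hv (hφ.of_le (by exact_mod_cast le_top))
    rw [hgv φ hφ hφc (hφs.trans Set.inter_subset_left), Finset.sum_eq_single F] at h1
    · obtain ⟨C, hC⟩ := hφ.continuous.bounded_above_of_compact_support hφc
      have hi : ∀ k : Vec d → ℝ, MemLp k 2 (volume.restrict Ω) →
          Integrable (fun x => k x * φ x) (volume.restrict Ω) := fun k hk =>
        (hk.integrable one_le_two).mul_bdd hφ.continuous.aestronglyMeasurable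
          (Filter.Eventually.of_forall hC)
      rw [← h1, neg_add_eq_sub, ← integral_sub (hi D hD) (hi g hg)]
      congr 1 with x
      simp only [Pi.sub_apply, smul_eq_mul]
      ring
    · intro E _ hE
      rw [facetInt_eq_zero fun x hx => ?_, mul_zero]
      exact image_eq_zero_of_notMem_tsupport fun h => Set.mem_iInter.1 (hφs h).2 E hE hx
    · simp
  have hae : ∀ᵐ x ∂(volume.restrict Ω), x ∈ U \ body F.1 → (D - g) x = 0 := by
    refine (hU.sdiff (isClosed_body F.1)).ae_eq_zero_of_integral_contDiff_smul_eq_zero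
      (hDi.locallyIntegrable.locallyIntegrableOn _) fun φ hφ hφc hφs => ?_
    rw [key φ hφ hφc (hφs.trans Set.sdiff_subset), facetInt_eq_zero fun x hx => ?_, mul_zero]
    exact image_eq_zero_of_notMem_tsupport fun h => (hφs h).2 hx
  obtain ⟨φ, hφs, hφc, hφ, hφr, hφ1⟩ := exists_contDiff_tsupport_subset (hU.mem_nhds hx₀U) (n := ⊤)
  have h1 := key φ hφ hφc hφs
  have h2 : ∫ x in Ω, φ x • (D - g) x = 0 := by
    refine integral_eq_zero_of_ae ?_
    have hFn : ∀ᵐ x ∂(volume.restrict Ω), x ∉ body F.1 :=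
      ae_restrict_of_ae (measure_eq_zero_iff_ae_notMem.1 (volume_facet F))
    filter_upwards [hae, hFn] with x hx hxF
    by_cases hxU : x ∈ U
    · rw [hx ⟨hxU, hxF⟩, smul_zero, Pi.zero_apply]
    · rw [image_eq_zero_of_notMem_tsupport fun h => hxU (hφs h), zero_smul, Pi.zero_apply]
  rw [h2] at h1
  have h3 : 0 < facetInt F.1 φ := facetInt_pos hx₀F hx₀ hφ.continuous
    (fun y => (hφr (Set.mem_range_self y)).1) (by rw [hφ1]; exact one_pos)
  exact (mul_eq_zero.1 h1.symm).resolve_right h3.ne'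

/-- The outward normals on a facet inside the domain cancel, because constant fields are
divergence free. -/
lemma sum_normal_eq_zero (hΩ : IsOpen Ω) (hT : T.Triangulates Ω) {F : T.Facet}
    (hF : ¬ T.IsBoundary Ω F) : ∑ K : T.Cell with F ∈ T.facetsOf K, normal K.1 F.1 = 0 := by
  refine ext_inner_left ℝ fun e => ?_
  rw [inner_zero_right, inner_sum]
  refine jump_eq_zero_of_memHDiv hΩ hT (v := fun _ _ => e) (fun K => ⟨e, 0, by simp⟩) ?_ hF
  refine ⟨memLp_assemble fun K => continuous_const, 0, MemLp.zero, fun φ hφ hφc hφs => ?_⟩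
  have hφ1 : ContDiff ℝ 1 φ := hφ.of_le (by exact_mod_cast le_top)
  have hφ' : Continuous fun x => fderiv ℝ φ x e :=
    (hφ1.continuous_fderiv one_ne_zero).clm_apply continuous_const
  have hsupp : Function.support (fun x => fderiv ℝ φ x e) ⊆ Ω := by
    refine Set.Subset.trans (fun x hx => ?_) hφs
    by_contra h
    have : fderiv ℝ φ x = 0 := by
      by_contra h0
      exact h (support_fderiv_subset ℝ h0)
    simp [this] at hx
  have h1 : ∫ x in Ω, fderiv ℝ φ x (assemble T (fun (_ : T.Cell) _ => e) x) =
      ∫ x in Ω, fderiv ℝ φ x e := by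
    rw [(integral_domain hΩ hT (gK := fun _ x => fderiv ℝ φ x e)
      (fun K x hx => by rw [assemble_eq _ hx]) fun K => integrableOn_cell K hφ').2,
      (integral_domain hΩ hT (gK := fun _ x => fderiv ℝ φ x e)
      (fun K x hx => rfl) fun K => integrableOn_cell K hφ').2]
  rw [h1, setIntegral_eq_integral_of_forall_compl_eq_zero fun x hx => by
    by_contra h; exact hx (hsupp h)]
  have hφc' : HasCompactSupport fun x => fderiv ℝ φ x e :=
    hφc.of_isClosed_subset (isClosed_tsupport _)
      (closure_minimal (fun x hx => by
        by_contra h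
        have : fderiv ℝ φ x = 0 := by
          by_contra h0
          exact h (support_fderiv_subset ℝ h0)
        simp [this] at hx) (isClosed_tsupport _))
  have h2 := integral_mul_fderiv_eq_neg_fderiv_mul_of_integrable (μ := (volume : Measure (Vec d)))
    (f := fun _ => (1 : ℝ)) (g := φ) (v := e) (by simp)
    (by simpa using hφ'.integrable_of_hasCompactSupport hφc')
    (by simpa using hφ.continuous.integrable_of_hasCompactSupport hφc)
    (fun x _ => differentiableAt_const _) (fun x _ => hφ1.differentiable one_ne_zero x)
  simpa using h2

/-- Moving from the barycenter of a facet against the outward normal leads into the element. -/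
lemma eventually_mem_interior {K : T.Cell} {F : T.Facet} (h : F ∈ T.facetsOf K) :
    ∀ᶠ t in nhdsWithin (0 : ℝ) (Set.Ioi 0),
      bary F.1 + t • -normal K.1 F.1 ∈ interior (body K.1) := by
  obtain ⟨p, rfl⟩ := exists_opp_eq h
  rw [interior_cell]
  simp only [Set.mem_ofPred_eq, Filter.eventually_all]
  intro q
  have hg := norm_gradLam_pos K p
  by_cases hq : q = p
  · filter_upwards [self_mem_nhdsWithin] with t ht
    have ht : 0 < t := ht
    rw [hq, lam_add, lam_bary_opp, if_pos rfl, normal_opp, neg_neg, inner_smul_right,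
      inner_smul_right, real_inner_self_eq_norm_sq]
    positivity
  · have hcont : Continuous fun t : ℝ => lam K q (bary (opp K p).1 + t • -normal K.1 (opp K p).1) :=
      (continuous_lam K q).comp (by fun_prop)
    refine nhdsWithin_le_nhds (hcont.continuousAt.eventually (lt_mem_nhds ?_))
    have : 0 < (d : ℝ)⁻¹ := inv_pos.2 (Nat.cast_pos.2 (NeZero.pos d))
    simpa [lam_bary_opp, hq] using NeZero.pos d

/-- Two elements lie on different sides of a common facet. -/
lemma normal_eq_neg {K K' : T.Cell} {F : T.Facet} (hne : K ≠ K') (h : F ∈ T.facetsOf K)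
    (h' : F ∈ T.facetsOf K') : normal K'.1 F.1 = -normal K.1 F.1 := by
  refine (normal_eq_or_neg h h').resolve_left fun heq => hne ?_
  have h2 := eventually_mem_interior h'
  rw [heq] at h2
  obtain ⟨t, h1, h2⟩ := ((eventually_mem_interior h).and h2).exists
  exact cell_eq_of_mem_interior h1 (interior_subset h2)

/-- On a facet of two elements the normal jump is the difference of their values, because no third
element contains the facet. -/
lemma jump_eq {K K' : T.Cell} {F : T.Facet} (hne : K ≠ K') (h : F ∈ T.facetsOf K)
    (h' : F ∈ T.facetsOf K') (v : T.Cell → Vec d → Vec d) :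
    jump v F = ⟪v K (bary F.1), normal K.1 F.1⟫ - ⟪v K' (bary F.1), normal K.1 F.1⟫ := by
  have hs : ({J : T.Cell | F ∈ T.facetsOf J} : Finset T.Cell) = {K, K'} := by
    ext J
    simp only [Finset.mem_filter, Finset.mem_univ, true_and, Finset.mem_insert,
      Finset.mem_singleton]
    constructor
    · intro hJ
      by_contra! hJn
      have h1 := normal_eq_neg hJn.1 hJ h
      rw [normal_eq_neg hJn.1.symm h hJ] at h1
      have h2 := normal_eq_neg hJn.2.symm h' hJ
      rw [normal_eq_neg hJn.1.symm h hJ, normal_eq_neg hne h h', neg_neg] at h2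
      have h3 := norm_normal h
      have h4 : normal K.1 F.1 = 0 := by
        have := eq_neg_iff_add_eq_zero.1 h2.symm
        rwa [← two_smul ℝ, smul_eq_zero_iff_right two_ne_zero] at this
      rw [h4, norm_zero] at h3
      norm_num at h3
    · rintro (rfl | rfl) <;> assumption
  rw [jump, hs, Finset.sum_pair hne, normal_eq_neg hne h h', inner_neg_right, sub_eq_add_neg]

end

section

/-! ### Normal and tangential components -/

lemma inner_smul_add_tng (n w : Vec d) : ⟪w, n⟫ • n + tng n w = w := by simp [tng]

lemma tng_neg_normal (n w : Vec d) : tng (-n) w = tng n w := by simp [tng]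

lemma tng_of_orthogonal {n w : Vec d} (h : ⟪w, n⟫ = 0) : tng n w = w := by simp [tng, h]

lemma inner_tng_self {n : Vec d} (hn : ⟪n, n⟫ = 1) (w : Vec d) : ⟪tng n w, n⟫ = 0 := by
  rw [tng, inner_sub_left, inner_smul_left, hn]; simp

lemma tng_sub (n v w : Vec d) : tng n (v - w) = tng n v - tng n w := by
  simp only [tng, inner_sub_left, sub_smul]; abel

lemma tng_tng {n : Vec d} (hn : ⟪n, n⟫ = 1) (w : Vec d) : tng n (tng n w) = tng n w :=
  tng_of_orthogonal (inner_tng_self hn w)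

lemma inner_smul_add_tng_self {n : Vec d} (hn : ⟪n, n⟫ = 1) (c : ℝ) (w : Vec d) :
    ⟪c • n + tng n w, n⟫ = c := by
  rw [inner_add_left, inner_tng_self hn, inner_smul_left, hn]; simp

lemma tng_smul_add_tng {n : Vec d} (hn : ⟪n, n⟫ = 1) (c : ℝ) (w : Vec d) :
    tng n (c • n + tng n w) = tng n w := by
  rw [tng, inner_smul_add_tng_self hn, add_sub_cancel_left]

lemma inner_tng_left (n v w : Vec d) : ⟪tng n v, w⟫ = ⟪v, tng n w⟫ := by
  simp only [tng, inner_sub_left, inner_sub_right, inner_smul_left, inner_smul_right,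
    conj_trivial, real_inner_comm]
  ring

lemma exists_affine_of_rt {v : Vec d → Vec d} (hv : ∃ (a : Vec d) (b : ℝ), ∀ x, v x = a + b • x) :
    ∃ A : Vec d →ᵃ[ℝ] Vec d, v = A := by
  obtain ⟨a, b, hv⟩ := hv
  refine ⟨(b • LinearMap.id : Vec d →ₗ[ℝ] Vec d).toAffineMap + AffineMap.const ℝ (Vec d) a, ?_⟩
  ext1 x
  simp [hv, add_comm]

lemma grad_eq_grad_zero {v : Vec d → Vec d} (hv : ∃ A : Vec d →ᵃ[ℝ] Vec d, v = A) (x : Vec d) :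
    grad v x = grad v 0 := by
  obtain ⟨A, rfl⟩ := hv
  rw [grad_affineMap, grad_affineMap]

/-! ### The inner product of matrices -/

lemma frob_add_left (A B C : Mat d) : frob (A + B) C = frob A C + frob B C := by
  simp [frob, add_mul, Finset.sum_add_distrib]

lemma frob_smul_left (c : ℝ) (A B : Mat d) : frob (c • A) B = c * frob A B := by
  simp [frob, Finset.mul_sum, mul_assoc]

lemma frob_comm (A B : Mat d) : frob A B = frob B A := by simp [frob, mul_comm]

lemma frob_self_nonneg (A : Mat d) : 0 ≤ frob A A :=
  Finset.sum_nonneg fun _ _ => Finset.sum_nonneg fun _ _ => mul_self_nonneg _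

lemma frob_self_eq_zero {A : Mat d} (h : frob A A = 0) : A = 0 := by
  ext i j
  have h1 := (Finset.sum_eq_zero_iff_of_nonneg
    fun _ _ => Finset.sum_nonneg fun _ _ => mul_self_nonneg _).1 h i (Finset.mem_univ i)
  have h2 := (Finset.sum_eq_zero_iff_of_nonneg fun _ _ => mul_self_nonneg _).1 h1 j
    (Finset.mem_univ j)
  exact mul_self_eq_zero.1 h2

lemma eq_zero_of_sum_volume_mul_frob {X : T.Cell → Mat d}
    (h : ∑ K : T.Cell, volume.real (body K.1) * frob (X K) (X K) = 0) (K : T.Cell) : X K = 0 := by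
  rw [Finset.sum_eq_zero_iff_of_nonneg
    fun K _ => mul_nonneg (volume_cell_pos K).le (frob_self_nonneg _)] at h
  exact frob_self_eq_zero
    ((mul_eq_zero.1 (h K (Finset.mem_univ K))).resolve_left (volume_cell_pos K).ne')

variable [NeZero d]

/-! ### The interpolation operators -/

/-- The local formula for `Π^RT v`. -/
def rtOf (v : T.Cell → Vec d → Vec d) (K : T.Cell) : Vec d → Vec d :=
  rtLoc K fun F => ⟪v K (bary F.1), normal K.1 F.1⟫

/-- The local formula for `Π^CR (v, v')`. -/
def crOf (v : T.Cell → Vec d → Vec d) (v' : T.Facet → Vec d) (K : T.Cell) : Vec d → Vec d :=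
  crLoc K fun F => ⟪v K (bary F.1), normal K.1 F.1⟫ • normal K.1 F.1 + tng (normal K.1 F.1) (v' F)

/-- For piecewise Raviart-Thomas fields, membership in `H(div)` is the absence of normal jumps. -/
lemma mem_RT_iff (hΩ : IsOpen Ω) (hT : T.Triangulates Ω) {v : T.Cell → Vec d → Vec d} :
    v ∈ RT T Ω ↔ (∀ K, ∃ (a : Vec d) (b : ℝ), ∀ x, v K x = a + b • x) ∧
      ∀ F : T.Facet, ¬ T.IsBoundary Ω F → jump v F = 0 :=
  ⟨fun h => ⟨h.1, fun _ hF => jump_eq_zero_of_memHDiv hΩ hT h.1 h.2 hF⟩,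
    fun h => ⟨h.1, memHDiv_of_jump_eq_zero hΩ hT h.1 h.2⟩⟩

lemma inner_rtOf_normal (v : T.Cell → Vec d → Vec d) {K : T.Cell} {F : T.Facet}
    (h : F ∈ T.facetsOf K) {x : Vec d} (hx : x ∈ body F.1) :
    ⟪rtOf v K x, normal K.1 F.1⟫ = ⟪v K (bary F.1), normal K.1 F.1⟫ :=
  inner_rtLoc_normal _ h hx

/-- The normal jump of `rtOf v` vanishes as the two sides share the value of `v` at the barycenter
and their outward normals cancel. -/
lemma rtOf_mem_RT (hΩ : IsOpen Ω) (hT : T.Triangulates Ω) {v : T.Cell → Vec d → Vec d}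
    (hv : v ∈ CR T Ω) : rtOf v ∈ RT T Ω := by
  refine (mem_RT_iff hΩ hT).2 ⟨fun K => exists_rtLoc_eq K _, fun F hF => ?_⟩
  obtain ⟨K, hK⟩ := exists_cell_of_facet F
  have h : jump (rtOf v) F =
      ⟪v K (bary F.1), ∑ J : T.Cell with F ∈ T.facetsOf J, normal J.1 F.1⟫ := by
    rw [jump, inner_sum]
    refine Finset.sum_congr rfl fun J hJ => ?_
    have hJ := (Finset.mem_filter.1 hJ).2
    rw [inner_rtOf_normal v hJ (bary_mem_body F), hv.2 F hF J K hJ hK]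
  rw [h, sum_normal_eq_zero hΩ hT hF, inner_zero_right]

lemma isRTInterp_iff (hΩ : IsOpen Ω) (hT : T.Triangulates Ω) {v w : T.Cell → Vec d → Vec d}
    (hv : v ∈ CR T Ω) : IsRTInterp T Ω v w ↔ w = rtOf v := by
  have hflux : ∀ (K : T.Cell) (F : T.Facet), F ∈ T.facetsOf K →
      facetInt F.1 (fun x => ⟪v K x, normal K.1 F.1⟫) =
        area F.1 * ⟪v K (bary F.1), normal K.1 F.1⟫ := by
    intro K F hF
    obtain ⟨A, hA⟩ := hv.1 K
    have := facetInt_inner_affineMap hF A 0 (normal K.1 F.1)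
    simpa only [hA, sub_zero] using this
  constructor
  · rintro ⟨hw, hf⟩
    ext1 K
    rw [eq_rtLoc K (hw.1 K)]
    refine rtLoc_congr K fun F hF => ?_
    have h := hf K F hF
    rw [hflux K F hF, facetInt_congr (fun x hx => inner_normal_eq_bary (hw.1 K) hF hx),
      facetInt_const, mul_comm] at h
    exact mul_left_cancel₀ (area_pos hF).ne' h
  · rintro rfl
    refine ⟨rtOf_mem_RT hΩ hT hv, fun K F hF => ?_⟩
    rw [hflux K F hF, facetInt_congr (fun x hx => inner_rtOf_normal v hF hx), facetInt_const,
      mul_comm]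

lemma rtInterp_eq (hΩ : IsOpen Ω) (hT : T.Triangulates Ω) {v : T.Cell → Vec d → Vec d}
    (hv : v ∈ CR T Ω) : rtInterp T Ω v = rtOf v :=
  (isRTInterp_iff hΩ hT hv).1 (Classical.epsilon_spec ⟨rtOf v, (isRTInterp_iff hΩ hT hv).2 rfl⟩)

lemma crOf_bary (v : T.Cell → Vec d → Vec d) (v' : T.Facet → Vec d) {K : T.Cell} {F : T.Facet}
    (h : F ∈ T.facetsOf K) : crOf v v' K (bary F.1) =
      ⟪v K (bary F.1), normal K.1 F.1⟫ • normal K.1 F.1 + tng (normal K.1 F.1) (v' F) :=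
  crLoc_bary K _ h

lemma inner_crOf_normal (v : T.Cell → Vec d → Vec d) (v' : T.Facet → Vec d) {K : T.Cell}
    {F : T.Facet} (h : F ∈ T.facetsOf K) :
    ⟪crOf v v' K (bary F.1), normal K.1 F.1⟫ = ⟪v K (bary F.1), normal K.1 F.1⟫ := by
  rw [crOf_bary v v' h, inner_smul_add_tng_self (inner_normal_self h)]

lemma tng_crOf (v : T.Cell → Vec d → Vec d) (v' : T.Facet → Vec d) {K : T.Cell}
    {F : T.Facet} (h : F ∈ T.facetsOf K) :
    tng (normal K.1 F.1) (crOf v v' K (bary F.1)) = tng (normal K.1 F.1) (v' F) := by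
  rw [crOf_bary v v' h, tng_smul_add_tng (inner_normal_self h)]

lemma crOf_mem_CR (hΩ : IsOpen Ω) (hT : T.Triangulates Ω) {v : T.Cell → Vec d → Vec d}
    (hv : v ∈ RT T Ω) (v' : T.Facet → Vec d) : crOf v v' ∈ CR T Ω := by
  refine ⟨fun K => exists_affine_crLoc K _, fun F hF K K' hK hK' => ?_⟩
  by_cases hne : K = K'
  · rw [hne]
  · have hj := jump_eq hne hK hK' v
    rw [((mem_RT_iff hΩ hT).1 hv).2 F hF, eq_comm, sub_eq_zero] at hj
    rw [crOf_bary v v' hK, crOf_bary v v' hK', normal_eq_neg hne hK hK', tng_neg_normal,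
      inner_neg_right, smul_neg, neg_smul, neg_neg, hj]

lemma isCRInterp_iff (hΩ : IsOpen Ω) (hT : T.Triangulates Ω) {v w : T.Cell → Vec d → Vec d}
    (hv : v ∈ RT T Ω) (v' : T.Facet → Vec d) : IsCRInterp T Ω v v' w ↔ w = crOf v v' := by
  constructor
  · rintro ⟨hw, hf⟩
    ext1 K
    obtain ⟨A, hA⟩ := hw.1 K
    rw [hA, affineMap_eq_crLoc K A]
    refine crLoc_congr K fun F hF => ?_
    rw [← hA, ← inner_smul_add_tng (normal K.1 F.1) (w K (bary F.1)), (hf K F hF).1, (hf K F hF).2]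
  · rintro rfl
    exact ⟨crOf_mem_CR hΩ hT hv v', fun K F hF => ⟨inner_crOf_normal v v' hF, tng_crOf v v' hF⟩⟩

lemma crInterp_eq (hΩ : IsOpen Ω) (hT : T.Triangulates Ω) {v : T.Cell → Vec d → Vec d}
    (hv : v ∈ RT T Ω) (v' : T.Facet → Vec d) : crInterp T Ω v v' = crOf v v' :=
  (isCRInterp_iff hΩ hT hv v').1
    (Classical.epsilon_spec ⟨crOf v v', (isCRInterp_iff hΩ hT hv v').2 rfl⟩)

lemma rtOf_crOf {v : T.Cell → Vec d → Vec d} (hv : v ∈ RT T Ω) (v' : T.Facet → Vec d) :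
    rtOf (crOf v v') = v := by
  ext1 K
  rw [eq_rtLoc K (hv.1 K)]
  exact rtLoc_congr K fun F hF => inner_crOf_normal v v' hF

lemma crOf_mem_CRZero (hΩ : IsOpen Ω) (hT : T.Triangulates Ω) {v : T.Cell → Vec d → Vec d}
    (hv : v ∈ RTZero T Ω) {v' : T.Facet → Vec d} (hv' : v' ∈ HatZero T Ω) :
    crOf v v' ∈ CRZero T Ω := by
  refine ⟨crOf_mem_CR hΩ hT hv.1 v', fun K F hF hb => ?_⟩
  rw [crOf_bary v v' hF, hv.2 K F hF hb _ (bary_mem_body F), hv'.2 K F hF hb, zero_smul, add_zero]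

lemma rtInterp_crInterp (hΩ : IsOpen Ω) (hT : T.Triangulates Ω) {v : T.Cell → Vec d → Vec d}
    (hv : v ∈ RT T Ω) (v' : T.Facet → Vec d) : rtInterp T Ω (crInterp T Ω v v') = v := by
  rw [crInterp_eq hΩ hT hv, rtInterp_eq hΩ hT (crOf_mem_CR hΩ hT hv v'), rtOf_crOf hv]

/-- `Π^CR` is a bijection: its inverse takes the normal components at the barycenters as fluxes and
the tangential components as facet values. -/
lemma bijOn_crInterp (hΩ : IsOpen Ω) (hT : T.Triangulates Ω) :
    Set.BijOn (fun w : (T.Cell → Vec d → Vec d) × (T.Facet → Vec d) => crInterp T Ω w.1 w.2)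
      (RTZero T Ω ×ˢ HatZero T Ω) (CRZero T Ω) := by
  refine ⟨?_, ?_, ?_⟩
  · rintro ⟨u, u'⟩ ⟨hu, hu'⟩
    simp only [crInterp_eq hΩ hT hu.1]
    exact crOf_mem_CRZero hΩ hT hu hu'
  · rintro ⟨u, u'⟩ ⟨(hu : u ∈ RTZero T Ω), (hu' : u' ∈ HatZero T Ω)⟩ ⟨v, v'⟩
      ⟨(hv : v ∈ RTZero T Ω), (hv' : v' ∈ HatZero T Ω)⟩ h
    simp only [crInterp_eq hΩ hT hu.1, crInterp_eq hΩ hT hv.1] at h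
    refine Prod.ext ?_ ?_
    · change u = v
      rw [← rtOf_crOf hu.1 u', h, rtOf_crOf hv.1 v']
    · ext1 F
      change u' F = v' F
      obtain ⟨K, hK⟩ := exists_cell_of_facet F
      rw [← tng_of_orthogonal (hu'.1 K F hK), ← tng_of_orthogonal (hv'.1 K F hK),
        ← tng_crOf u u' hK, h, tng_crOf v v' hK]
  · intro w hw
    choose J hJ using fun F : T.Facet => exists_cell_of_facet F
    -- the tangential component does not depend on the choice of the element `J F` at the facet
    let u' : T.Facet → Vec d := fun F => tng (normal (J F).1 F.1) (w (J F) (bary F.1))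
    have hval : ∀ (K : T.Cell) (F : T.Facet), F ∈ T.facetsOf K →
        u' F = tng (normal K.1 F.1) (w K (bary F.1)) := by
      intro K F hF
      have h1 : w (J F) (bary F.1) = w K (bary F.1) := by
        by_cases hb : T.IsBoundary Ω F
        · rw [hw.2 K F hF hb, hw.2 _ F (hJ F) hb]
        · exact hw.1.2 F hb _ _ (hJ F) hF
      rcases normal_eq_or_neg (hJ F) hF with h | h
      · rw [h, ← h1]
      · rw [h, tng_neg_normal, ← h1]
    have hu : rtOf w ∈ RTZero T Ω := ⟨rtOf_mem_RT hΩ hT hw.1, fun K F hF hb x hx => by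
      rw [inner_rtOf_normal w hF hx, hw.2 K F hF hb, inner_zero_left]⟩
    have hu' : u' ∈ HatZero T Ω := by
      refine ⟨fun K F hF => ?_, fun K F hF hb => ?_⟩
      · rw [hval K F hF, inner_tng_self (inner_normal_self hF)]
      · rw [hval K F hF, hw.2 K F hF hb]
        simp [tng]
    refine ⟨(rtOf w, u'), ⟨hu, hu'⟩, ?_⟩
    simp only [crInterp_eq hΩ hT hu.1]
    ext1 K
    obtain ⟨A, hA⟩ := hw.1.1 K
    rw [hA, affineMap_eq_crLoc K A]
    refine crLoc_congr K fun F hF => ?_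
    rw [inner_rtOf_normal w hF (bary_mem_body F), hval K F hF, tng_tng (inner_normal_self hF),
      inner_smul_add_tng, hA]

/-! ### The condensed system -/

/-- The gradient form of the HDG scheme tests the gradient of the Crouzeix-Raviart interpolant:
both are given by the boundary terms of the divergence theorem with the same facet values. -/
lemma gradForm_eq {v : T.Cell → Vec d → Vec d}
    (hv : ∀ K, ∃ (a : Vec d) (b : ℝ), ∀ x, v K x = a + b • x) (v' : T.Facet → Vec d)
    (G : T.Cell → Mat d) : gradForm T v v' G =
      ∑ K : T.Cell, volume.real (body K.1) * frob (grad (crOf v v' K) 0) (G K) := by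
  rw [gradForm, ← Finset.sum_sub_distrib]
  refine Finset.sum_congr rfl fun K _ => ?_
  obtain ⟨A, hA⟩ := exists_affine_of_rt (hv K)
  obtain ⟨B, hB⟩ : ∃ B : Vec d →ᵃ[ℝ] Vec d, crOf v v' K = B := exists_affine_crLoc K _
  rw [hB, grad_affineMap, ← sum_area_inner_mulVec, hA, integral_frob_grad, ← sum_area_inner_mulVec,
    ← Finset.sum_sub_distrib]
  refine Finset.sum_congr rfl fun F hF => ?_
  have h1 : ∀ x, ⟪tng (normal K.1 F.1) (A x - v' F), mulVec (G K) (normal K.1 F.1)⟫ =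
      ⟪A x - v' F, tng (normal K.1 F.1) (mulVec (G K) (normal K.1 F.1))⟫ := fun x =>
    inner_tng_left _ _ _
  simp_rw [h1]
  rw [facetInt_inner_affineMap hF, ← inner_tng_left, ← mul_sub, ← inner_sub_left, ← hB,
    crOf_bary v v' hF, ← hA, tng_sub]
  congr 2
  nth_rewrite 1 [← inner_smul_add_tng (normal K.1 F.1) (v K (bary F.1))]
  abel

/-- The first equation of the HDG scheme says that `ν⁻¹ L + ∇ Π^CR (u, u')` is orthogonal to all
piecewise constant matrices, itself included. -/
lemma localEq_iff {ν : ℝ} (hν : 0 < ν) {u : T.Cell → Vec d → Vec d}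
    (hu : ∀ K, ∃ (a : Vec d) (b : ℝ), ∀ x, u K x = a + b • x) (u' : T.Facet → Vec d)
    (L : T.Cell → Mat d) :
    LocalEq T ν L u u' ↔ ∀ K, L K = -ν • grad (crOf u u' K) 0 := by
  have h : ∀ G : T.Cell → Mat d,
      (∑ K : T.Cell, ∫ _x in body K.1, frob (ν⁻¹ • L K) (G K)) + gradForm T u u' G =
        ∑ K : T.Cell, volume.real (body K.1) *
          frob (ν⁻¹ • L K + grad (crOf u u' K) 0) (G K) := by
    intro G
    rw [gradForm_eq hu, ← Finset.sum_add_distrib]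
    refine Finset.sum_congr rfl fun K _ => ?_
    rw [setIntegral_const, smul_eq_mul, frob_add_left, mul_add]
  simp only [LocalEq, h]
  constructor
  · intro hG K
    have h0 := eq_zero_of_sum_volume_mul_frob (hG _) K
    rw [add_eq_zero_iff_eq_neg, inv_smul_eq_iff₀ hν.ne'] at h0
    rw [h0, smul_neg, neg_smul]
  · intro hL G
    refine Finset.sum_eq_zero fun K _ => ?_
    rw [hL K, neg_smul, smul_neg, smul_smul, inv_mul_cancel₀ hν.ne', one_smul, neg_add_cancel]
    simp [frob]

lemma divForm_congr {u v : T.Cell → Vec d → Vec d} (hu : ∀ K, ∃ A : Vec d →ᵃ[ℝ] Vec d, u K = A)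
    (hv : ∀ K, ∃ A : Vec d →ᵃ[ℝ] Vec d, v K = A)
    (h : ∀ K : T.Cell, ∀ F ∈ T.facetsOf K,
      ⟪u K (bary F.1), normal K.1 F.1⟫ = ⟪v K (bary F.1), normal K.1 F.1⟫) (q : T.Cell → ℝ) :
    divForm T u q = divForm T v q := by
  refine Finset.sum_congr rfl fun K _ => ?_
  obtain ⟨A, hA⟩ := hu K
  obtain ⟨B, hB⟩ := hv K
  rw [hA, hB, integral_dvg, integral_dvg]
  congr 1
  refine Finset.sum_congr rfl fun F hF => ?_
  rw [← hA, ← hB, h K F hF]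

lemma divForm_crOf {v : T.Cell → Vec d → Vec d} (hv : v ∈ RT T Ω) (v' : T.Facet → Vec d)
    (q : T.Cell → ℝ) : divForm T v q = divForm T (crOf v v') q :=
  divForm_congr (fun K => exists_affine_of_rt (hv.1 K)) (fun K => exists_affine_crLoc K _)
    (fun _ _ hF => (inner_crOf_normal v v' hF).symm) q

lemma hdgMomentum_eq_crMomentum (hΩ : IsOpen Ω) (hT : T.Triangulates Ω) {ν : ℝ} (β : Vec d → ℝ)
    {u v : T.Cell → Vec d → Vec d} (hu : u ∈ RT T Ω) (hv : v ∈ RT T Ω) (u' v' : T.Facet → Vec d)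
    (p : T.Cell → ℝ) {L : T.Cell → Mat d} (hL : ∀ K, L K = -ν • grad (crOf u u' K) 0) :
    hdgMomentum T β L u p v v' = crMomentum T Ω ν β (crOf u u') p (crOf v v') := by
  rw [hdgMomentum, crMomentum, rtInterp_eq hΩ hT (crOf_mem_CR hΩ hT hu u'),
    rtInterp_eq hΩ hT (crOf_mem_CR hΩ hT hv v'), rtOf_crOf hu, rtOf_crOf hv, ← divForm_crOf hv,
    gradForm_eq hv.1, ← Finset.sum_neg_distrib, Finset.mul_sum]
  congr 2
  refine Finset.sum_congr rfl fun K _ => ?_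
  have hgu : ∀ x, grad (crOf u u' K) x = grad (crOf u u' K) 0 :=
    grad_eq_grad_zero (exists_affine_crLoc K _)
  have hgv : ∀ x, grad (crOf v v' K) x = grad (crOf v v' K) 0 :=
    grad_eq_grad_zero (exists_affine_crLoc K _)
  simp_rw [hgu, hgv]
  rw [setIntegral_const, smul_eq_mul, hL K, frob_comm, frob_smul_left]
  ring

end

section

/-! ### Solvability of the Crouzeix-Raviart scheme -/

lemma mem_PZero_iff (hΩ : IsOpen Ω) (hT : T.Triangulates Ω) {q : T.Cell → ℝ} :
    q ∈ PZero T Ω ↔ ∑ K : T.Cell, volume.real (body K.1) * q K = 0 := by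
  have h := (integral_domain hΩ hT (g := assemble T (fun K _ => q K)) (gK := fun K _ => q K)
    (fun K x hx => assemble_eq _ hx) fun K => integrableOn_cell K continuous_const).2
  change ∫ x in Ω, assemble T (fun K _ => q K) x = 0 ↔ _
  rw [h]
  simp_rw [setIntegral_const, smul_eq_mul]

/-- The facet values of the Crouzeix-Raviart fields that vanish on the boundary. -/
def facetDofs (T : Mesh d) (Ω : Set (Vec d)) : Submodule ℝ (T.Facet → Vec d) where
  carrier := {m | ∀ F, T.IsBoundary Ω F → m F = 0}
  add_mem' ha hb F hF := by simp [ha F hF, hb F hF]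
  zero_mem' _ _ := rfl
  smul_mem' c _ ha F hF := by simp [ha F hF]

/-- The piecewise constants with vanishing integral. -/
def cellDofs (T : Mesh d) : Submodule ℝ (T.Cell → ℝ) where
  carrier := {q | ∑ K : T.Cell, volume.real (body K.1) * q K = 0}
  add_mem' {a b} ha hb := by
    have ha : ∑ K : T.Cell, volume.real (body K.1) * a K = 0 := ha
    have hb : ∑ K : T.Cell, volume.real (body K.1) * b K = 0 := hb
    simp [mul_add, Finset.sum_add_distrib, ha, hb]
  zero_mem' := by simp
  smul_mem' c a ha := by
    have ha : ∑ K : T.Cell, volume.real (body K.1) * a K = 0 := ha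
    simp [mul_left_comm _ c, ← Finset.mul_sum, ha]

lemma cell_integrableOn_mul {β : Vec d → ℝ} (hβ : ∀ K : T.Cell, IntegrableOn β (body K.1))
    {u v : T.Cell → Vec d → Vec d} (hu : ∀ K, Continuous (u K)) (hv : ∀ K, Continuous (v K))
    (K : T.Cell) : IntegrableOn (fun x => β x * ⟪u K x, v K x⟫) (body K.1) :=
  (hβ K).mul_continuousOn ((hu K).inner (hv K)).continuousOn (isCompact_body _)

lemma massForm_comm (β : Vec d → ℝ) (u v : T.Cell → Vec d → Vec d) :
    massForm T β u v = massForm T β v u := by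
  simp_rw [massForm, real_inner_comm]

lemma massForm_add_left {β : Vec d → ℝ} (hβ : ∀ K : T.Cell, IntegrableOn β (body K.1))
    {u₁ u₂ v : T.Cell → Vec d → Vec d} (hu₁ : ∀ K, Continuous (u₁ K))
    (hu₂ : ∀ K, Continuous (u₂ K)) (hv : ∀ K, Continuous (v K)) :
    massForm T β (u₁ + u₂) v = massForm T β u₁ v + massForm T β u₂ v := by
  simp_rw [massForm, ← Finset.sum_add_distrib]
  refine Finset.sum_congr rfl fun K _ => ?_
  rw [← integral_add (cell_integrableOn_mul hβ hu₁ hv K) (cell_integrableOn_mul hβ hu₂ hv K)]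
  simp_rw [Pi.add_apply, inner_add_left, mul_add]

lemma massForm_smul_left (β : Vec d → ℝ) (c : ℝ) (u v : T.Cell → Vec d → Vec d) :
    massForm T β (c • u) v = c * massForm T β u v := by
  simp_rw [massForm, Finset.mul_sum, ← integral_const_mul, Pi.smul_apply, inner_smul_left,
    conj_trivial, mul_left_comm]

lemma massForm_self_nonneg {β : Vec d → ℝ}
    (hβ : ∀ K : T.Cell, ∀ᵐ x ∂(volume.restrict (body K.1)), 0 ≤ β x)
    (u : T.Cell → Vec d → Vec d) : 0 ≤ massForm T β u u := by
  refine Finset.sum_nonneg fun K _ => integral_nonneg_of_ae ?_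
  filter_upwards [hβ K] with x hx
  exact mul_nonneg hx real_inner_self_nonneg

lemma cell_integrableOn_inner {f : Vec d → Vec d} (hf : ∀ K : T.Cell, IntegrableOn f (body K.1))
    {v : T.Cell → Vec d → Vec d} (hv : ∀ K, Continuous (v K)) (K : T.Cell) :
    IntegrableOn (fun x => ⟪f x, v K x⟫) (body K.1) := by
  obtain ⟨C, hC⟩ := (isCompact_body K.1).exists_bound_of_continuousOn (hv K).continuousOn
  refine Integrable.mono' ((hf K).norm.mul_const C)
    ((hf K).aestronglyMeasurable.inner (hv K).aestronglyMeasurable) ?_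
  refine (ae_restrict_iff' (isClosed_body K.1).measurableSet).2
    (Filter.Eventually.of_forall fun x hx => ?_)
  exact (norm_inner_le_norm _ _).trans (mul_le_mul_of_nonneg_left (hC x hx) (norm_nonneg _))

lemma source_add {f : Vec d → Vec d} (hf : ∀ K : T.Cell, IntegrableOn f (body K.1))
    {u v : T.Cell → Vec d → Vec d} (hu : ∀ K, Continuous (u K)) (hv : ∀ K, Continuous (v K)) :
    source T f (u + v) = source T f u + source T f v := by
  simp_rw [source, ← Finset.sum_add_distrib]
  refine Finset.sum_congr rfl fun K _ => ?_
  rw [← integral_add (cell_integrableOn_inner hf hu K) (cell_integrableOn_inner hf hv K)]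
  simp_rw [Pi.add_apply, inner_add_right]

lemma source_smul (f : Vec d → Vec d) (c : ℝ) (v : T.Cell → Vec d → Vec d) :
    source T f (c • v) = c * source T f v := by
  simp_rw [source, Finset.mul_sum, ← integral_const_mul, Pi.smul_apply, inner_smul_right]

/-- The divergence form in terms of the facet values. -/
def fluxForm (T : Mesh d) (m : T.Facet → Vec d) (q : T.Cell → ℝ) : ℝ :=
  ∑ K : T.Cell, (∑ F ∈ T.facetsOf K, area F.1 * ⟪m F, normal K.1 F.1⟫) * q K

lemma fluxForm_eq_sum_jump (m : T.Facet → Vec d) (q : T.Cell → ℝ) :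
    fluxForm T m q = ∑ F : T.Facet, area F.1 * jump (fun K _ => q K • m F) F := by
  simp_rw [fluxForm, jump, Finset.sum_mul, Finset.mul_sum]
  rw [sum_cells_facets (fun (K : T.Cell) (F : T.Facet) =>
    area F.1 * ⟪m F, normal K.1 F.1⟫ * q K)]
  refine Finset.sum_congr rfl fun F _ => Finset.sum_congr rfl fun K _ => ?_
  rw [inner_smul_left, conj_trivial]
  ring

variable [NeZero d]

lemma crLoc_add (K : T.Cell) (m m' : T.Facet → Vec d) (x : Vec d) :
    crLoc K (m + m') x = crLoc K m x + crLoc K m' x := by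
  simp [crLoc, Finset.sum_add_distrib]

lemma crLoc_smul (K : T.Cell) (c : ℝ) (m : T.Facet → Vec d) (x : Vec d) :
    crLoc K (c • m) x = c • crLoc K m x := by
  simp_rw [crLoc, Finset.smul_sum, Pi.smul_apply, smul_comm c]

lemma grad_crLoc (K : T.Cell) (m : T.Facet → Vec d) (x : Vec d) :
    grad (crLoc K m) x = Matrix.of fun i j =>
      crLoc K m (EuclideanSpace.single j 1) i - crLoc K m 0 i := by
  obtain ⟨A, hA⟩ := exists_affine_crLoc K m
  rw [hA, grad_affineMap]
  ext i j
  have : A.linear (EuclideanSpace.single j 1) = A (EuclideanSpace.single j 1) - A 0 := by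
    rw [← vsub_eq_sub (A _), ← AffineMap.linearMap_vsub, vsub_eq_sub, sub_zero]
  simp [affGrad, this]

lemma grad_crLoc_add (K : T.Cell) (m m' : T.Facet → Vec d) (x : Vec d) :
    grad (crLoc K (m + m')) x = grad (crLoc K m) x + grad (crLoc K m') x := by
  ext i j
  simp only [grad_crLoc, crLoc_add, Matrix.of_apply, Matrix.add_apply, PiLp.add_apply]
  ring

lemma grad_crLoc_smul (K : T.Cell) (c : ℝ) (m : T.Facet → Vec d) (x : Vec d) :
    grad (crLoc K (c • m)) x = c • grad (crLoc K m) x := by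
  ext i j
  simp only [grad_crLoc, crLoc_smul, Matrix.of_apply, Matrix.smul_apply, PiLp.smul_apply,
    smul_eq_mul]
  ring

/-- The Raviart-Thomas reconstruction of the Crouzeix-Raviart field with the facet values `m`. -/
def rtDof (T : Mesh d) (m : T.Facet → Vec d) (K : T.Cell) : Vec d → Vec d :=
  rtLoc K fun F => ⟪m F, normal K.1 F.1⟫

lemma rtDof_add (m m' : T.Facet → Vec d) : rtDof T (m + m') = rtDof T m + rtDof T m' := by
  ext1 K; ext1 x
  simp [rtDof, rtLoc, inner_add_left, add_mul, add_smul, Finset.sum_add_distrib]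

lemma rtDof_smul (c : ℝ) (m : T.Facet → Vec d) : rtDof T (c • m) = c • rtDof T m := by
  ext1 K; ext1 x
  simp [rtDof, rtLoc, inner_smul_left, Finset.smul_sum, smul_smul, mul_assoc]

lemma continuous_rtDof (m : T.Facet → Vec d) (K : T.Cell) : Continuous (rtDof T m K) := by
  unfold rtDof rtLoc
  fun_prop

lemma rtOf_crLoc (m : T.Facet → Vec d) : rtOf (fun K : T.Cell => crLoc K m) = rtDof T m := by
  ext1 K
  exact rtLoc_congr K fun F hF => by beta_reduce; rw [crLoc_bary K m hF]

lemma crLoc_mem_CRZero {m : T.Facet → Vec d} (hm : m ∈ facetDofs T Ω) :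
    (fun K => crLoc K m) ∈ CRZero T Ω :=
  ⟨⟨fun K => exists_affine_crLoc K m, fun F _ K K' hK hK' => by
    beta_reduce
    rw [crLoc_bary K m hK, crLoc_bary K' m hK']⟩, fun K F hF hb => by
    beta_reduce
    rw [crLoc_bary K m hF, hm F hb]⟩

/-- A Crouzeix-Raviart field vanishing on the boundary has facet values in `facetDofs`. -/
lemma exists_facetDofs {v : T.Cell → Vec d → Vec d} (hv : v ∈ CRZero T Ω) :
    ∃ m ∈ facetDofs T Ω, v = fun K => crLoc K m := by
  choose J hJ using fun F : T.Facet => exists_cell_of_facet F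
  refine ⟨fun F => v (J F) (bary F.1), fun F hF => hv.2 _ F (hJ F) hF, ?_⟩
  ext1 K
  obtain ⟨A, hA⟩ := hv.1.1 K
  rw [hA, affineMap_eq_crLoc K A]
  refine crLoc_congr K fun F hF => ?_
  rw [← hA]
  by_cases hb : T.IsBoundary Ω F
  · rw [hv.2 K F hF hb, hv.2 _ F (hJ F) hb]
  · exact hv.1.2 F hb _ _ hF (hJ F)

/-- The velocity form of the Crouzeix-Raviart scheme in terms of the facet values. -/
def velForm (T : Mesh d) (ν : ℝ) (β : Vec d → ℝ) (m m' : T.Facet → Vec d) : ℝ :=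
  ν * (∑ K : T.Cell, volume.real (body K.1) * frob (grad (crLoc K m) 0) (grad (crLoc K m') 0)) +
    massForm T β (rtDof T m) (rtDof T m')

lemma divForm_crLoc (m : T.Facet → Vec d) (q : T.Cell → ℝ) :
    divForm T (fun K => crLoc K m) q = fluxForm T m q := by
  refine Finset.sum_congr rfl fun K _ => ?_
  obtain ⟨A, hA⟩ := exists_affine_crLoc K m
  simp only [hA]
  rw [integral_dvg]
  congr 1
  exact Finset.sum_congr rfl fun F hF => by rw [← hA, crLoc_bary K m hF]

lemma crMomentum_crLoc (hΩ : IsOpen Ω) (hT : T.Triangulates Ω) (ν : ℝ) (β : Vec d → ℝ)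
    {m m' : T.Facet → Vec d} (hm : m ∈ facetDofs T Ω) (hm' : m' ∈ facetDofs T Ω)
    (p : T.Cell → ℝ) :
    crMomentum T Ω ν β (fun K => crLoc K m) p (fun K => crLoc K m') =
      velForm T ν β m m' - fluxForm T m' p := by
  rw [crMomentum, rtInterp_eq hΩ hT (crLoc_mem_CRZero hm).1,
    rtInterp_eq hΩ hT (crLoc_mem_CRZero hm').1, rtOf_crLoc, rtOf_crLoc, divForm_crLoc, velForm]
  congr 3
  refine Finset.sum_congr rfl fun K _ => ?_
  have h : ∀ (k : T.Facet → Vec d) (x : Vec d), grad (crLoc K k) x = grad (crLoc K k) 0 :=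
    fun k => grad_eq_grad_zero (exists_affine_crLoc K k)
  simp_rw [h m, h m']
  rw [setIntegral_const, smul_eq_mul]

/-- The two equations of the Crouzeix-Raviart scheme, added up to one bilinear form on facet values
and pressures. -/
def systemForm (T : Mesh d) (Ω : Set (Vec d)) (ν : ℝ) {β : Vec d → ℝ}
    (hβ : ∀ K : T.Cell, IntegrableOn β (body K.1)) :
    (facetDofs T Ω × cellDofs T) →ₗ[ℝ] Module.Dual ℝ (facetDofs T Ω × cellDofs T) :=
  LinearMap.mk₂ ℝ (fun x y => velForm T ν β x.1 y.1 - fluxForm T y.1 x.2 + fluxForm T x.1 y.2)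
    (fun x x' y => by
      simp only [velForm, fluxForm, Prod.fst_add, Prod.snd_add, Submodule.coe_add, rtDof_add,
        grad_crLoc_add, frob_add_left, mul_add, Pi.add_apply, inner_add_left, add_mul,
        Finset.sum_add_distrib,
        massForm_add_left hβ (continuous_rtDof _) (continuous_rtDof _) (continuous_rtDof _)]
      ring)
    (fun c x y => by
      simp only [velForm, fluxForm, Prod.smul_fst, Prod.smul_snd, Submodule.coe_smul, rtDof_smul,
        grad_crLoc_smul, frob_smul_left, massForm_smul_left, Pi.smul_apply, inner_smul_left,
        conj_trivial, smul_eq_mul, mul_left_comm _ c, mul_assoc c, ← Finset.mul_sum]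
      ring)
    (fun x y y' => by
      simp only [velForm, fluxForm, Prod.fst_add, Prod.snd_add, Submodule.coe_add, rtDof_add,
        grad_crLoc_add, frob_comm (grad _ _) (_ + _), massForm_comm β (rtDof T x.1),
        frob_add_left, mul_add, Pi.add_apply, inner_add_left, add_mul, Finset.sum_add_distrib,
        massForm_add_left hβ (continuous_rtDof _) (continuous_rtDof _) (continuous_rtDof _)]
      simp only [frob_comm]
      ring)
    (fun c x y => by
      simp only [velForm, fluxForm, Prod.smul_fst, Prod.smul_snd, Submodule.coe_smul, rtDof_smul,
        grad_crLoc_smul, frob_comm (grad _ _) (_ • _), massForm_comm β (rtDof T x.1),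
        frob_smul_left, massForm_smul_left, Pi.smul_apply, inner_smul_left,
        conj_trivial, smul_eq_mul, mul_left_comm _ c, mul_assoc c, ← Finset.mul_sum]
      simp only [frob_comm]
      ring)

/-- A Crouzeix-Raviart field with vanishing gradient and boundary values vanishes: its elementwise
constant values `c K` agree on common facets, and the divergence theorem for the piecewise field
`|c K|² x` gives `∑ K, |c K|² |K| = 0`. -/
lemma eq_zero_of_grad_eq_zero (hΩ : IsOpen Ω) (hT : T.Triangulates Ω) {m : T.Facet → Vec d}
    (hm : m ∈ facetDofs T Ω) (hg : ∀ K : T.Cell, grad (crLoc K m) 0 = 0) : m = 0 := by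
  have hconst : ∀ (K : T.Cell) (x : Vec d), crLoc K m x = crLoc K m 0 := by
    intro K x
    obtain ⟨A, hA⟩ := exists_affine_crLoc K m
    have h0 := hg K
    rw [hA, grad_affineMap] at h0
    have h1 : A.linear = 0 := by
      refine (EuclideanSpace.basisFun (Fin d) ℝ).toBasis.ext fun j => ?_
      ext i
      have := congrFun (congrFun h0 i) j
      simpa [affGrad] using this
    rw [hA, AffineMap.decomp A]
    simp [h1]
  have hmF : ∀ (K : T.Cell) (F : T.Facet), F ∈ T.facetsOf K → m F = crLoc K m 0 := by
    intro K F hF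
    rw [← crLoc_bary K m hF, hconst]
  have hflux : ∀ K : T.Cell,
      ∑ F ∈ T.facetsOf K, area F.1 * ⟪‖m F‖ ^ 2 • bary F.1, normal K.1 F.1⟫ =
        volume.real (body K.1) * (‖crLoc K m 0‖ ^ 2 * d) := by
    intro K
    have h := sum_area_inner_mulVec K
      ((‖crLoc K m 0‖ ^ 2 • LinearMap.id : Vec d →ₗ[ℝ] Vec d).toAffineMap) 1
    have htr : frob (affGrad ((‖crLoc K m 0‖ ^ 2 • LinearMap.id :
        Vec d →ₗ[ℝ] Vec d).toAffineMap)) 1 = ‖crLoc K m 0‖ ^ 2 * d := by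
      rw [frob_one, Matrix.trace]
      simp [affGrad, mul_comm]
    rw [htr] at h
    rw [← h]
    refine Finset.sum_congr rfl fun F hF => ?_
    rw [hmF K F hF, mulVec_one]
    rfl
  have hsum : ∑ K : T.Cell, volume.real (body K.1) * (‖crLoc K m 0‖ ^ 2 * d) = 0 := by
    simp_rw [← hflux]
    rw [sum_cells_facets (fun (K : T.Cell) (F : T.Facet) =>
      area F.1 * ⟪‖m F‖ ^ 2 • bary F.1, normal K.1 F.1⟫)]
    refine Finset.sum_eq_zero fun F _ => ?_
    rw [← Finset.mul_sum, ← inner_sum]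
    by_cases hb : T.IsBoundary Ω F
    · rw [hm F hb]
      simp
    · rw [sum_normal_eq_zero hΩ hT hb, inner_zero_right, mul_zero]
  ext1 F
  obtain ⟨K, hK⟩ := exists_cell_of_facet F
  have h0 := (Finset.sum_eq_zero_iff_of_nonneg fun K _ => by
    have := volume_cell_pos K
    positivity).1 hsum K (Finset.mem_univ K)
  have hd : (d : ℝ) ≠ 0 := Nat.cast_ne_zero.2 (NeZero.ne d)
  rw [hmF K F hK]
  simpa [(volume_cell_pos K).ne', hd] using h0

/-- A pressure that is orthogonal to the divergences of all Crouzeix-Raviart fields is constant: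
testing with the normal field on one facet compares the values on the two sides. -/
lemma eq_zero_of_fluxForm_eq_zero (hΩ : IsOpen Ω) (hΩc : IsConnected Ω) (hT : T.Triangulates Ω)
    {p : T.Cell → ℝ} (hp : p ∈ cellDofs T) (h : ∀ m ∈ facetDofs T Ω, fluxForm T m p = 0) :
    p = 0 := by
  ext1 K₀
  have hC : {K | p K = p K₀} = Set.univ := by
    refine eq_univ_of_adjacent hΩ hΩc hT ⟨K₀, rfl⟩ fun K hK K' F hF hFK hFK' => ?_
    have hK : p K = p K₀ := hK
    by_cases hne : K = K'
    · exact hne ▸ hK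
    have hm : Pi.single F (normal K.1 F.1) ∈ facetDofs T Ω := by
      intro E hE
      exact Pi.single_eq_of_ne (by rintro rfl; exact hF hE) _
    have h0 := h _ hm
    rw [fluxForm_eq_sum_jump, Finset.sum_eq_single F, Pi.single_eq_same, jump_eq hne hFK hFK',
      inner_smul_left, inner_smul_left, inner_normal_self hFK] at h0
    · have h1 := (mul_eq_zero.1 h0).resolve_left (area_pos hFK).ne'
      simp only [conj_trivial, mul_one] at h1
      change p K' = p K₀
      linarith
    · intro E _ hE
      simp [Pi.single_eq_of_ne hE, jump]
    · simp
  have hp : ∑ K : T.Cell, volume.real (body K.1) * p K = 0 := hp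
  have hconst : ∀ K, p K = p K₀ := fun K => by
    have : K ∈ {K | p K = p K₀} := hC ▸ Set.mem_univ K
    exact this
  simp_rw [hconst] at hp
  rw [← Finset.sum_mul] at hp
  have hpos : 0 < ∑ K : T.Cell, volume.real (body K.1) :=
    Finset.sum_pos (fun K _ => volume_cell_pos K) ⟨K₀, Finset.mem_univ K₀⟩
  exact (mul_eq_zero.1 hp).resolve_left hpos.ne'

/-- The system matrix is square, so injectivity suffices. -/
lemma systemForm_bijective (hΩ : IsOpen Ω) (hΩc : IsConnected Ω) (hT : T.Triangulates Ω) {ν : ℝ}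
    (hν : 0 < ν) {β : Vec d → ℝ} (hβ : ∀ K : T.Cell, IntegrableOn β (body K.1))
    (hβ0 : ∀ K : T.Cell, ∀ᵐ x ∂(volume.restrict (body K.1)), 0 ≤ β x) :
    Function.Bijective (systemForm T Ω ν hβ) := by
  have hinj : Function.Injective (systemForm T Ω ν hβ) := by
    rw [← LinearMap.ker_eq_bot, LinearMap.ker_eq_bot']
    rintro ⟨⟨m, hm⟩, ⟨p, hp⟩⟩ hx
    have hform : ∀ m' ∈ facetDofs T Ω, ∀ q ∈ cellDofs T,
        velForm T ν β m m' - fluxForm T m' p + fluxForm T m q = 0 := fun m' hm' q hq =>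
      LinearMap.congr_fun hx (⟨m', hm'⟩, ⟨q, hq⟩)
    -- testing with the solution itself, the two pressure terms cancel
    have h1 : velForm T ν β m m = 0 := by
      have := hform m hm p hp
      linarith
    have h2 := massForm_self_nonneg hβ0 (rtDof T m)
    have h3 : 0 ≤ ∑ K : T.Cell,
        volume.real (body K.1) * frob (grad (crLoc K m) 0) (grad (crLoc K m) 0) :=
      Finset.sum_nonneg fun K _ => mul_nonneg (volume_cell_pos K).le (frob_self_nonneg _)
    have h4 : ∑ K : T.Cell,
        volume.real (body K.1) * frob (grad (crLoc K m) 0) (grad (crLoc K m) 0) = 0 := by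
      rw [velForm] at h1
      nlinarith [mul_nonneg hν.le h3]
    have hm0 : m = 0 := eq_zero_of_grad_eq_zero hΩ hT hm (eq_zero_of_sum_volume_mul_frob h4)
    subst hm0
    have hp0 : p = 0 := by
      refine eq_zero_of_fluxForm_eq_zero hΩ hΩc hT hp fun m' hm' => ?_
      have h5 := hform m' hm' 0 (Submodule.zero_mem _)
      have h6 : velForm T ν β 0 m' = 0 := by
        have := LinearMap.congr_fun (LinearMap.map_zero (systemForm T Ω ν hβ)) (⟨m', hm'⟩, 0)
        have h7 : velForm T ν β 0 m' - fluxForm T m' 0 + fluxForm T 0 0 = 0 := this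
        simpa [fluxForm] using h7
      rw [h6] at h5
      have h8 : fluxForm T (0 : T.Facet → Vec d) 0 = 0 := by simp [fluxForm]
      linarith
    subst hp0
    rfl
  exact ⟨hinj, (LinearMap.injective_iff_surjective_of_finrank_eq_finrank
    Subspace.dual_finrank_eq.symm).1 hinj⟩

/-- The source term as a functional of the facet values. -/
def sourceForm (T : Mesh d) (Ω : Set (Vec d)) {f : Vec d → Vec d}
    (hf : ∀ K : T.Cell, IntegrableOn f (body K.1)) :
    Module.Dual ℝ (facetDofs T Ω × cellDofs T) where
  toFun x := source T f (rtDof T x.1)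
  map_add' x y := by
    simp only [Prod.fst_add, Submodule.coe_add, rtDof_add]
    exact source_add hf (continuous_rtDof _) (continuous_rtDof _)
  map_smul' c x := by
    simp only [Prod.smul_fst, Submodule.coe_smul, rtDof_smul, source_smul, RingHom.id_apply,
      smul_eq_mul]

lemma isCRSolution_crLoc_iff (hΩ : IsOpen Ω) (hT : T.Triangulates Ω) (ν : ℝ) {β : Vec d → ℝ}
    (hβ : ∀ K : T.Cell, IntegrableOn β (body K.1)) {f : Vec d → Vec d}
    (hf : ∀ K : T.Cell, IntegrableOn f (body K.1)) (x : facetDofs T Ω × cellDofs T) :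
    IsCRSolution T Ω ν β f (fun K => crLoc K x.1) x.2 ↔
      systemForm T Ω ν hβ x = sourceForm T Ω hf := by
  obtain ⟨⟨m, hm⟩, ⟨p, hp⟩⟩ := x
  have hsrc : ∀ m' ∈ facetDofs T Ω,
      source T f (rtInterp T Ω fun K => crLoc K m') = source T f (rtDof T m') := fun m' hm' => by
    rw [rtInterp_eq hΩ hT (crLoc_mem_CRZero hm').1, rtOf_crLoc]
  constructor
  · intro h
    refine LinearMap.ext ?_
    rintro ⟨⟨m', hm'⟩, ⟨q, hq⟩⟩
    have h1 := h.momentum _ (crLoc_mem_CRZero hm')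
    have h2 := h.incompressible q ((mem_PZero_iff hΩ hT).2 hq)
    rw [hsrc m' hm', crMomentum_crLoc hΩ hT ν β hm hm' p] at h1
    rw [divForm_crLoc] at h2
    change velForm T ν β m m' - fluxForm T m' p + fluxForm T m q = source T f (rtDof T m')
    rw [h1]
    exact (congrArg _ h2).trans (add_zero _)
  · intro h
    have hform : ∀ m' ∈ facetDofs T Ω, ∀ q ∈ cellDofs T,
        velForm T ν β m m' - fluxForm T m' p + fluxForm T m q = source T f (rtDof T m') :=
      fun m' hm' q hq => LinearMap.congr_fun h (⟨m', hm'⟩, ⟨q, hq⟩)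
    refine ⟨crLoc_mem_CRZero hm, (mem_PZero_iff hΩ hT).2 hp, fun v hv => ?_, fun q hq => ?_⟩
    · obtain ⟨m', hm', rfl⟩ := exists_facetDofs hv
      have h1 := hform m' hm' 0 (Submodule.zero_mem _)
      have h2 : fluxForm T m 0 = 0 := by simp [fluxForm]
      rw [hsrc m' hm', crMomentum_crLoc hΩ hT ν β hm hm' p, ← h1, h2, add_zero]
    · have h1 := hform 0 (Submodule.zero_mem _) q ((mem_PZero_iff hΩ hT).1 hq)
      have h3 := hform 0 (Submodule.zero_mem _) 0 (Submodule.zero_mem _)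
      have h2 : fluxForm T m 0 = 0 := by simp [fluxForm]
      change divForm T (fun K => crLoc K m) q = 0
      rw [divForm_crLoc]
      linarith

lemma existsUnique_isCRSolution (hΩ : IsOpen Ω) (hΩc : IsConnected Ω) (hT : T.Triangulates Ω)
    {ν : ℝ} (hν : 0 < ν) {β : Vec d → ℝ} (hβ : ∀ K : T.Cell, IntegrableOn β (body K.1))
    (hβ0 : ∀ K : T.Cell, ∀ᵐ x ∂(volume.restrict (body K.1)), 0 ≤ β x) {f : Vec d → Vec d}
    (hf : ∀ K : T.Cell, IntegrableOn f (body K.1)) :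
    ∃! s : (T.Cell → Vec d → Vec d) × (T.Cell → ℝ), IsCRSolution T Ω ν β f s.1 s.2 := by
  obtain ⟨hinj, hsurj⟩ := systemForm_bijective hΩ hΩc hT hν hβ hβ0
  obtain ⟨x, hx⟩ := hsurj (sourceForm T Ω hf)
  refine ⟨(fun K => crLoc K x.1, x.2), (isCRSolution_crLoc_iff hΩ hT ν hβ hf x).2 hx, ?_⟩
  rintro ⟨u, p⟩ h
  obtain ⟨m, hm, hu⟩ := exists_facetDofs h.mem_u
  have hp : p ∈ cellDofs T := (mem_PZero_iff hΩ hT).1 h.mem_p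
  simp only at hu
  subst hu
  have hy := (isCRSolution_crLoc_iff hΩ hT ν hβ hf (⟨m, hm⟩, ⟨p, hp⟩)).1 h
  have := hinj (hy.trans hx.symm)
  subst this
  rfl

/-! ### The equivalence of the two schemes -/

/-- The HDG scheme with eliminated `L` is the Crouzeix-Raviart scheme for `Π^CR (u, u')`. -/
lemma isHDGSolution_iff (hΩ : IsOpen Ω) (hT : T.Triangulates Ω) {ν : ℝ} (hν : 0 < ν)
    {β : Vec d → ℝ} {f : Vec d → Vec d} {L : T.Cell → Mat d} {u : T.Cell → Vec d → Vec d}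
    {u' : T.Facet → Vec d} {p : T.Cell → ℝ} :
    IsHDGSolution T Ω ν β f L u u' p ↔ u ∈ RTZero T Ω ∧ u' ∈ HatZero T Ω ∧
      (∀ K, L K = -ν • grad (crOf u u' K) 0) ∧ IsCRSolution T Ω ν β f (crOf u u') p := by
  have hrt : ∀ v ∈ RT T Ω, ∀ v', rtInterp T Ω (crOf v v') = v := fun v hv v' => by
    rw [← crInterp_eq hΩ hT hv, rtInterp_crInterp hΩ hT hv]
  constructor
  · intro h
    have hL := (localEq_iff hν h.mem_u.1.1 u' L).1 h.local_eq
    refine ⟨h.mem_u, h.mem_u', hL, crOf_mem_CRZero hΩ hT h.mem_u h.mem_u', h.mem_p,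
      fun w hw => ?_, fun q hq => ?_⟩
    · obtain ⟨⟨v, v'⟩, ⟨(hv : v ∈ RTZero T Ω), (hv' : v' ∈ HatZero T Ω)⟩, rfl⟩ :=
        (bijOn_crInterp hΩ hT).surjOn hw
      simp only [crInterp_eq hΩ hT hv.1]
      rw [← hdgMomentum_eq_crMomentum hΩ hT β h.mem_u.1 hv.1 u' v' p hL, h.momentum v hv v' hv',
        hrt v hv.1]
    · rw [← divForm_crOf h.mem_u.1, h.incompressible q hq]
  · rintro ⟨hu, hu', hL, h⟩
    refine ⟨hu, hu', h.mem_p, (localEq_iff hν hu.1.1 u' L).2 hL, fun v hv v' hv' => ?_,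
      fun q hq => ?_⟩
    · rw [hdgMomentum_eq_crMomentum hΩ hT β hu.1 hv.1 u' v' p hL,
        h.momentum _ (crOf_mem_CRZero hΩ hT hv hv'), hrt v hv.1]
    · rw [divForm_crOf hu.1 u', h.incompressible q hq]

end

end

end StokesHDG

theorem theorem3p2 (d : ℕ) (hd : d = 2 ∨ d = 3)
    (Ω : Set (Vec d)) (hΩ : IsOpen Ω) (hΩc : IsConnected Ω)
    (T : Mesh d) (hT : T.Triangulates Ω)
    (ν : ℝ) (hν : 0 < ν)
    (β : Vec d → ℝ) (β₀ β₁ : ℝ) (hβ₀ : 0 ≤ β₀)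
    (hβm : AEStronglyMeasurable β (volume.restrict Ω))
    (hβ : ∀ᵐ x ∂(volume.restrict Ω), β₀ ≤ β x ∧ β x ≤ β₁)
    (f : Vec d → Vec d) (hf : MemLp f 2 (volume.restrict Ω)) :
    -- the interpolation operators are well defined
    (∀ v ∈ CR T Ω, ∃! w, IsRTInterp T Ω v w) ∧
    (∀ v ∈ RT T Ω, ∀ v' ∈ Hat T, ∃! w, IsCRInterp T Ω v v' w) ∧
    -- both schemes are uniquely solvable
    (∃! s : (T.Cell → Vec d → Vec d) × (T.Cell → ℝ), IsCRSolution T Ω ν β f s.1 s.2) ∧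
    (∃! s : (T.Cell → Mat d) × (T.Cell → Vec d → Vec d) × (T.Facet → Vec d) × (T.Cell → ℝ),
      IsHDGSolution T Ω ν β f s.1 s.2.1 s.2.2.1 s.2.2.2) ∧
    -- the relation between the two solutions
    (∀ L u u' p uCR pCR, IsHDGSolution T Ω ν β f L u u' p → IsCRSolution T Ω ν β f uCR pCR →
      (∀ K, ∀ x ∈ body K.1, L K = -ν • grad (uCR K) x) ∧
      crInterp T Ω u u' = uCR ∧
      p = pCR) ∧
    -- the condensed HDG system is the Crouzeix-Raviart system
    Set.BijOn (fun w : (T.Cell → Vec d → Vec d) × (T.Facet → Vec d) => crInterp T Ω w.1 w.2)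
      (RTZero T Ω ×ˢ HatZero T Ω) (CRZero T Ω) ∧
    (∀ u ∈ RTZero T Ω, ∀ u' ∈ HatZero T Ω,
      ∀ L, LocalEq T ν L u u' ↔
        ∀ K, ∀ x ∈ body K.1, L K = -ν • grad (crInterp T Ω u u' K) x) ∧
    (∀ u ∈ RTZero T Ω, ∀ u' ∈ HatZero T Ω, ∀ L, LocalEq T ν L u u' → ∀ p q : T.Cell → ℝ,
      ∀ v ∈ RTZero T Ω, ∀ v' ∈ HatZero T Ω,
        hdgMomentum T β L u p v v' =
          crMomentum T Ω ν β (crInterp T Ω u u') p (crInterp T Ω v v') ∧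
        source T f v = source T f (rtInterp T Ω (crInterp T Ω v v')) ∧
        divForm T u q = divForm T (crInterp T Ω u u') q) := by
  have : NeZero d := ⟨by omega⟩
  have hβ0 : ∀ K : T.Cell, ∀ᵐ x ∂(volume.restrict (body K.1)), 0 ≤ β x := fun K => by
    filter_upwards [ae_cell_of_ae_domain hΩ hT hβ K] with x hx using hβ₀.trans hx.1
  have hfin : IsFiniteMeasure (volume.restrict Ω) :=
    ⟨by rw [Measure.restrict_apply_univ]; exact measure_domain_lt_top hT⟩
  have hcell : ∀ K : T.Cell, volume.restrict (body K.1) ≤ volume.restrict Ω := fun K => by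
    rw [restrict_domain hΩ hT]
    exact Measure.restrict_mono (Set.subset_iUnion (fun K : T.Cell => body K.1) K) le_rfl
  have hβi : ∀ K : T.Cell, IntegrableOn β (body K.1) := fun K => by
    have h : Integrable β (volume.restrict Ω) := by
      refine Integrable.of_bound hβm β₁ ?_
      filter_upwards [hβ] with x hx
      rw [Real.norm_of_nonneg (hβ₀.trans hx.1)]
      exact hx.2
    exact h.mono_measure (hcell K)
  have hfi : ∀ K : T.Cell, IntegrableOn f (body K.1) := fun K =>
    (hf.integrable one_le_two).mono_measure (hcell K)
  have hCR := existsUnique_isCRSolution hΩ hΩc hT hν hβi hβ0 hfi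
  have hgrad : ∀ (w : T.Cell → Vec d → Vec d), w ∈ CR T Ω → ∀ L : T.Cell → Mat d,
      (∀ K, ∀ x ∈ body K.1, L K = -ν • grad (w K) x) ↔ ∀ K, L K = -ν • grad (w K) 0 := by
    intro w hw L
    refine forall_congr' fun K => ⟨fun h => ?_, fun h x _ => ?_⟩
    · rw [h _ (interior_subset (bary_mem_interior K)), grad_eq_grad_zero (hw.1 K)]
    · rw [h, grad_eq_grad_zero (hw.1 K) x]
  refine ⟨fun v hv => ⟨rtOf v, (isRTInterp_iff hΩ hT hv).2 rfl, fun w hw =>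
      (isRTInterp_iff hΩ hT hv).1 hw⟩,
    fun v hv v' _ => ⟨crOf v v', (isCRInterp_iff hΩ hT hv v').2 rfl, fun w hw =>
      (isCRInterp_iff hΩ hT hv v').1 hw⟩, hCR, ?_, ?_, bijOn_crInterp hΩ hT, ?_, ?_⟩
  · obtain ⟨⟨w, p⟩, hw, hwu⟩ := hCR
    obtain ⟨⟨u, u'⟩, ⟨(hu : u ∈ RTZero T Ω), (hu' : u' ∈ HatZero T Ω)⟩, huw⟩ :=
      (bijOn_crInterp hΩ hT).surjOn hw.mem_u
    simp only [crInterp_eq hΩ hT hu.1] at huw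
    refine ⟨(fun K => -ν • grad (w K) 0, u, u', p), (isHDGSolution_iff hΩ hT hν).2
      ⟨hu, hu', fun K => by rw [huw], huw ▸ hw⟩, ?_⟩
    rintro ⟨L, v, v', q⟩ h
    obtain ⟨hv, hv', hL, hs⟩ := (isHDGSolution_iff hΩ hT hν).1 h
    have h1 := hwu (crOf v v', q) hs
    simp only [Prod.mk.injEq] at h1
    have h2 := (bijOn_crInterp hΩ hT).injOn (Set.mk_mem_prod hv hv') (Set.mk_mem_prod hu hu') (by
      simp only [crInterp_eq hΩ hT hu.1, crInterp_eq hΩ hT hv.1]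
      rw [h1.1, huw])
    simp only [Prod.mk.injEq] at h2 ⊢
    exact ⟨funext fun K => by rw [← h1.1]; exact hL K, h2.1, h2.2, h1.2⟩
  · intro L u u' p uCR pCR h hcr
    obtain ⟨hu, hu', hL, hs⟩ := (isHDGSolution_iff hΩ hT hν).1 h
    have h1 : (crOf u u', p) = (uCR, pCR) := hCR.unique hs hcr
    simp only [Prod.mk.injEq] at h1
    rw [hgrad uCR hcr.mem_u.1, crInterp_eq hΩ hT hu.1, ← h1.1]
    exact ⟨hL, rfl, h1.2⟩
  · intro u hu u' hu' L
    rw [crInterp_eq hΩ hT hu.1, hgrad _ (crOf_mem_CR hΩ hT hu.1 u'), localEq_iff hν hu.1.1]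
  · intro u hu u' hu' L hL p q v hv v' hv'
    rw [rtInterp_crInterp hΩ hT hv.1, crInterp_eq hΩ hT hu.1, crInterp_eq hΩ hT hv.1]
    exact ⟨hdgMomentum_eq_crMomentum hΩ hT β hu.1 hv.1 u' v' p
      ((localEq_iff hν hu.1.1 u' L).1 hL), rfl, divForm_crOf hu.1 u' q⟩
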